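/- Let $(W,S)$, $S=\{s_1,s_2,s_3\}$, be a Coxeter system of affine type of rank two, with $m_{ij}$ the order of $s_is_j$, labelled so that $(m_{12},m_{23},m_{13})$ is $(3,3,3)$ (type $\tilde A_2$), $(4,2,4)$ (type $\tilde C_2$) or $(6,2,3)$ (type $\tilde G_2$); let $\ell$ be its length function. Put $$(w_1,w_2)=\begin{cases}(s_3s_2s_1,\ s_3s_1s_2) & \text{type } \tilde A_2,\\ (s_3s_1s_2s_1,\ s_3s_1s_2) & \text{type } \tilde C_2,\\ (s_3s_1s_2,\ s_3s_1s_2s_1s_2) & \text{type } \tilde G_2,\end{cases}$$ and $H_i=\{w_i^n : n\ge 0\}$ for $i=1,2$. Let $k$ be a field, let $q\in k$, and let $H_q(W,S)$ be the Hecke algebra: the associative unital $k$-algebra with generators $e_w$ $(w\in W)$ and relations $e_1=1$, $(e_s+1)(e_s-q)=0$ for $s\in S$, and $e_we_v=e_{wv}$ whenever $\ell(wv)=\ell(w)+\ell(v)$. Let $\rho\colon H_q(W,S)\to \mathrm{End}_k(V)$ be a representation on a finite-dimensional $k$-vector space $V$. For $D\subseteq W$ put $$D(\rho,u)=\sum_{w\in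 D}\rho(e_w)u^{\ell(w)}\in \mathrm{End}_k(V)[[u]],$$ and let $\det D(\rho,u)\in k[[u]]$ be its determinant. For $I\subseteq S$ let $W_I$ be the subgroup of $W$ generated by $I$, and put $$\det \mathrm{Alt}(W)(\rho,u)=\prod_{I\subseteq S}\bigl(\det W_I(\rho,u)\bigr)^{(-1)^{|I|+|S|}},$$ where the inverses exist because each $\det W_I(\rho,u)$ has constant term $1$. Then $$\det H_1(\rho,u)\cdot\det H_2(\rho,u)=\det \mathrm{Alt}(W)(\rho,u)\quad\text{in } k[[u]].$$ -/

import Mathlib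

open PowerSeries

noncomputable section

/-- The three types of affine Coxeter groups of rank two. -/
inductive AffineType
  | A2
  | C2
  | G2

/-- The Coxeter matrices `(m_ij)` of the three types; the indices `0, 1, 2` stand for the
generators `s_1, s_2, s_3`.  The values of `(m_12, m_23, m_13)` are `(3, 3, 3)`, `(4, 2, 4)`
and `(6, 2, 3)`. -/
def AffineType.coxeterMatrix : AffineType → CoxeterMatrix (Fin 3)
  | .A2 =>
    { M := !![1, 3, 3;
              3, 1, 3;
              3, 3, 1]
      isSymm := by decide
      diagonal := by decide
      off_diagonal := by intro i j h; fin_cases i <;> fin_cases j <;> simp_all }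
  | .C2 =>
    { M := !![1, 4, 4;
              4, 1, 2;
              4, 2, 1]
      isSymm := by decide
      diagonal := by decide
      off_diagonal := by intro i j h; fin_cases i <;> fin_cases j <;> simp_all }
  | .G2 =>
    { M := !![1, 6, 3;
              6, 1, 2;
              3, 2, 1]
      isSymm := by decide
      diagonal := by decide
      off_diagonal := by intro i j h; fin_cases i <;> fin_cases j <;> simp_all }

section Hecke

variable {B : Type*} {M : CoxeterMatrix B} {W : Type*} [Group W] {k : Type*} [Field k]

/-- The defining relations of the Hecke algebra, between generators `e_w`, `w ∈ W`:
`e_1 = 1`, `(e_s + 1)(e_s - q) = 0` for the simple reflections `s`, and `e_w e_v = e_{wv}`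
whenever `ℓ(wv) = ℓ(w) + ℓ(v)`. -/
inductive HeckeRel (cs : CoxeterSystem M W) (q : k) : FreeAlgebra k W → FreeAlgebra k W → Prop
  | one : HeckeRel cs q (FreeAlgebra.ι k 1) 1
  | quadratic (i : B) : HeckeRel cs q
      ((FreeAlgebra.ι k (cs.simple i) + 1) *
        (FreeAlgebra.ι k (cs.simple i) - algebraMap k (FreeAlgebra k W) q)) 0
  | mul (w v : W) (h : cs.length (w * v) = cs.length w + cs.length v) : HeckeRel cs q
      (FreeAlgebra.ι k w * FreeAlgebra.ι k v) (FreeAlgebra.ι k (w * v))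

/-- The Hecke algebra `H_q(W, S)` over the field `k` with parameter `q ∈ k`. -/
def HeckeAlgebra (cs : CoxeterSystem M W) (q : k) : Type _ := RingQuot (HeckeRel cs q)

instance (cs : CoxeterSystem M W) (q : k) : Ring (HeckeAlgebra cs q) :=
  inferInstanceAs (Ring (RingQuot (HeckeRel cs q)))

instance (cs : CoxeterSystem M W) (q : k) : Algebra k (HeckeAlgebra cs q) :=
  inferInstanceAs (Algebra k (RingQuot (HeckeRel cs q)))

/-- The generator `e_w` of the Hecke algebra. -/
def HeckeAlgebra.e (cs : CoxeterSystem M W) (q : k) (w : W) : HeckeAlgebra cs q :=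
  RingQuot.mkAlgHom k (HeckeRel cs q) (FreeAlgebra.ι k w)

theorem CoxeterSystem.finite_length_eq [Finite B] (cs : CoxeterSystem M W) (D : Set W) (n : ℕ) :
    {w | w ∈ D ∧ cs.length w = n}.Finite := by
  refine ((List.finite_length_eq B n).image cs.wordProd).subset ?_
  rintro w ⟨-, hw⟩
  obtain ⟨ω, hω, rfl⟩ := cs.exists_isReduced w
  exact ⟨ω, hω.symm.trans hw, rfl⟩

/-- The twisted Poincaré series `D(ρ, u) = ∑_{w ∈ D} ρ(e_w) u^{ℓ(w)}` in `End(V)[[u]]`: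
its `n`-th coefficient is the sum of `ρ(e_w)` over the finitely many `w ∈ D` of length `n`. -/
def twistedPoincare [Finite B] (cs : CoxeterSystem M W) {q : k} {V : Type*} [AddCommGroup V]
    [Module k V] (ρ : HeckeAlgebra cs q →ₐ[k] Module.End k V) (D : Set W) :
    PowerSeries (Module.End k V) :=
  PowerSeries.mk fun n =>
    ∑ w ∈ (cs.finite_length_eq D n).toFinset, ρ (HeckeAlgebra.e cs q w)

end Hecke

section Det

variable {k : Type*} [Field k] {V : Type*} [AddCommGroup V] [Module k V]

/-- The matrix over `k[[u]]` of a power series with coefficients in `End(V)`, in a basis. -/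
def seriesMatrix {ι : Type*} [Fintype ι] [DecidableEq ι] (b : Module.Basis ι k V)
    (F : PowerSeries (Module.End k V)) : Matrix ι ι k⟦X⟧ :=
  Matrix.of fun i j => PowerSeries.mk fun n => LinearMap.toMatrix b b (coeff n F) i j

/-- The determinant in `k[[u]]` of an element of `End(V)[[u]]`, for `V` finite-dimensional. -/
def seriesDet [FiniteDimensional k V] (F : PowerSeries (Module.End k V)) : k⟦X⟧ :=
  (seriesMatrix (Module.finBasis k V) F).det

theorem seriesMatrix_mul {ι : Type*} [Fintype ι] [DecidableEq ι] (b : Module.Basis ι k V)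
    (F G : PowerSeries (Module.End k V)) :
    seriesMatrix b (F * G) = seriesMatrix b F * seriesMatrix b G := by
  ext i j n
  simp only [seriesMatrix, Matrix.of_apply, coeff_mk, PowerSeries.coeff_mul, Matrix.mul_apply,
    map_sum, Matrix.sum_apply, LinearMap.toMatrix_mul]
  rw [Finset.sum_comm]

/-- The determinant does not depend on the basis. -/
theorem seriesDet_eq [FiniteDimensional k V] {ι : Type*} [Fintype ι] [DecidableEq ι]
    (b : Module.Basis ι k V) (F : PowerSeries (Module.End k V)) :
    seriesDet F = (seriesMatrix b F).det := by
  let b' := Module.finBasis k V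
  let P : Matrix (Fin (Module.finrank k V)) ι k⟦X⟧ := (b'.toMatrix b).map (C (R := k))
  let Q : Matrix ι (Fin (Module.finrank k V)) k⟦X⟧ := (b.toMatrix b').map (C (R := k))
  have hPQ : P * Q = 1 := by
    rw [← Matrix.map_mul, Module.Basis.toMatrix_mul_toMatrix_flip]
    exact Matrix.map_one _ (map_zero _) (map_one _)
  have hQP : Q * P = 1 := by
    rw [← Matrix.map_mul, Module.Basis.toMatrix_mul_toMatrix_flip]
    exact Matrix.map_one _ (map_zero _) (map_one _)
  have h : seriesMatrix b' F = P * seriesMatrix b F * Q := by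
    ext i j n
    have h := congrFun (congrFun
      (basis_toMatrix_mul_linearMap_toMatrix_mul_basis_toMatrix b' b b' b (coeff n F)) i) j
    simp only [seriesMatrix, Matrix.of_apply, coeff_mk]
    rw [← h]
    simp only [P, Q, Matrix.mul_apply, map_sum, coeff_C_mul, coeff_mul_C,
      Matrix.map_apply, Matrix.of_apply, coeff_mk]
  change (seriesMatrix b' F).det = _
  rw [h, Matrix.det_conj_of_mul_eq_one hPQ hQP]

/-- A series with constant term the identity has a determinant with constant coefficient `1`. -/
theorem constantCoeff_seriesDet [FiniteDimensional k V] (F : PowerSeries (Module.End k V))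
    (hF : coeff 0 F = 1) : constantCoeff (seriesDet F) = 1 := by
  have h : (constantCoeff (R := k)).mapMatrix (seriesMatrix (Module.finBasis k V) F) = 1 := by
    ext i j
    rw [← LinearMap.toMatrix_one (Module.finBasis k V), ← hF]
    rw [RingHom.mapMatrix_apply, Matrix.map_apply, seriesMatrix, Matrix.of_apply,
      ← coeff_zero_eq_constantCoeff_apply, coeff_mk]
  rw [seriesDet, RingHom.map_det, h, Matrix.det_one]

end Det

theorem coeff_zero_twistedPoincare {B : Type*} [Finite B] {M : CoxeterMatrix B} {W : Type*}
    [Group W] {k : Type*} [Field k] (cs : CoxeterSystem M W) {q : k} {V : Type*}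
    [AddCommGroup V] [Module k V] (ρ : HeckeAlgebra cs q →ₐ[k] Module.End k V) (D : Set W)
    (hD : 1 ∈ D) : coeff 0 (twistedPoincare cs ρ D) = 1 := by
  have h1 : (cs.finite_length_eq D 0).toFinset = {1} := by
    ext w
    simp only [Set.Finite.mem_toFinset, Set.mem_ofPred_eq, Finset.mem_singleton,
      cs.length_eq_zero_iff]
    exact ⟨fun h => h.2, fun h => ⟨h ▸ hD, h⟩⟩
  have h2 : HeckeAlgebra.e cs q 1 = 1 :=
    (RingQuot.mkAlgHom_rel k (HeckeRel.one (cs := cs) (q := q))).trans (map_one _)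
  rw [twistedPoincare, coeff_mk, h1, Finset.sum_singleton, h2, map_one]

section Alt

variable {M : CoxeterMatrix (Fin 3)} {W : Type*} [Group W] {k : Type*} [Field k]

/-- The standard parabolic subgroup `W_I`, generated by the `s_i` with `i ∈ I`. -/
def parabolic (cs : CoxeterSystem M W) (I : Finset (Fin 3)) : Subgroup W :=
  Subgroup.closure (cs.simple '' (I : Set (Fin 3)))

/-- `det Alt(W)(ρ, u)`, the product over all `I ⊆ S` of `det W_I(ρ, u)` raised to the power
`(-1)^(|I| + |S|)`, where `|S| = 3`.  The inverses are those of power series with constant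
coefficient `1`. -/
def detAlt (cs : CoxeterSystem M W) {q : k} {V : Type*} [AddCommGroup V] [Module k V]
    [FiniteDimensional k V] (ρ : HeckeAlgebra cs q →ₐ[k] Module.End k V) : k⟦X⟧ :=
  ∏ I : Finset (Fin 3),
    if Even (I.card + 3) then seriesDet (twistedPoincare cs ρ (parabolic cs I))
    else (seriesDet (twistedPoincare cs ρ (parabolic cs I)))⁻¹

end Alt

section Strips

variable {W : Type*} [Group W]

/-- The element `w_1`, a generator of the stabilizer of a straight strip of the first kind. -/
def stripElement₁ (T : AffineType) (cs : CoxeterSystem T.coxeterMatrix W) : W :=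
  let s₁ := cs.simple 0
  let s₂ := cs.simple 1
  let s₃ := cs.simple 2
  match T with
  | .A2 => s₃ * s₂ * s₁
  | .C2 => s₃ * s₁ * s₂ * s₁
  | .G2 => s₃ * s₁ * s₂

/-- The element `w_2`, a generator of the stabilizer of a straight strip of the second kind. -/
def stripElement₂ (T : AffineType) (cs : CoxeterSystem T.coxeterMatrix W) : W :=
  let s₁ := cs.simple 0
  let s₂ := cs.simple 1
  let s₃ := cs.simple 2
  match T with
  | .A2 => s₃ * s₁ * s₂
  | .C2 => s₃ * s₁ * s₂
  | .G2 => s₃ * s₁ * s₂ * s₁ * s₂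

/-- The set `{w ^ n | n ≥ 0}`. -/
def powersSet (w : W) : Set W := Set.range fun n : ℕ => w ^ n

end Strips

end

/-! Write a, b, c for the terms `ρ(e_s) u` of the three simple reflections. The powers of w_i have
additive length, so the series of H_i is geometric with inverse 1 - w_i(a,b,c), where w_i(a,b,c) is
the word of w_i in a, b, c (`twistedPoincare_powersSet_mul`). Straightness of w_i is seen on
alcoves: |⌊α⌋| summed over the positive roots α bounds the length from below, and it grows by
exactly ℓ(w_i) at each step along a strip (`length_pow_wordProd`).

On the other side, every W_I has a transversal of elements without left descents in I, with lengths
adding (a consequence of the exchange property). No element of an infinite Coxeter group has all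
left descents, so inclusion-exclusion expresses W(u)⁻¹ as an alternating sum of the W_I(u)⁻¹
(`inv_twistedPoincare_univ`).

What remains is an identity in a noncommutative ring whose elements a, b, c satisfy braid relations.
With Wac = (1+a)p and Wab = (1+a)r, the product p W⁻¹ (1+a) r contains only the inverse of Wbc
(`det_factorization`). The braid relations factor it into 1 - w₁ and 1 - w₂: exactly in type C₂, and
after cyclic moves det(1 - xy) = det(1 - yx) in types A₂ and G₂ (`det_identity_C2`,
`det_identity_A2`, `det_identity_G2`). -/

namespace CoxeterSystem

/-! ### The exchange property and minimal coset representatives. -/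

open List

variable {B : Type*} {M : CoxeterMatrix B} {W : Type*} [Group W] (cs : CoxeterSystem M W)

open Classical in
/-- The action of a simple reflection on pairs consisting of a group element and a sign:
conjugation, with a change of sign at the reflection itself. -/
noncomputable def signedConj (i : B) : Function.End (W × ZMod 2) := fun p =>
  (cs.simple i * p.1 * cs.simple i, p.2 + if p.1 = cs.simple i then 1 else 0)

-- The sign counts how often the conjugated element meets a simple reflection, which is the
-- multiplicity of `p.1` in the inversion sequence.
open Classical in
theorem prod_map_signedConj (ω : List B) (p : W × ZMod 2) :
    (ω.map cs.signedConj).prod p =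
      (cs.wordProd ω * p.1 * (cs.wordProd ω)⁻¹,
        p.2 + ((cs.rightInvSeq ω).count p.1 : ZMod 2)) := by
  induction ω with
  | nil => simp; rfl
  | cons i ω ih =>
    have h : ((i :: ω).map cs.signedConj).prod p =
        cs.signedConj i ((ω.map cs.signedConj).prod p) := by
      rw [List.map_cons, List.prod_cons]; rfl
    rw [h, ih]
    have key : cs.wordProd ω * p.1 * (cs.wordProd ω)⁻¹ = cs.simple i ↔
        (cs.wordProd ω)⁻¹ * cs.simple i * cs.wordProd ω = p.1 := by
      constructor
      · intro h; rw [← h]; group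
      · intro h; rw [← h]; group
    simp only [signedConj, wordProd_cons, rightInvSeq, List.count_cons, key, mul_inv_rev,
      inv_simple, beq_iff_eq, Nat.cast_add, Nat.cast_ite, Nat.cast_one, Nat.cast_zero, add_assoc]
    simp only [mul_assoc]

theorem map_alternatingWord_prod {G : Type*} [Monoid G] (f : B → G) (i j : B) (n : ℕ) :
    ((alternatingWord i j (2 * n)).map f).prod = (f i * f j) ^ n := by
  induction n with
  | zero => simp [alternatingWord]
  | succ n ih =>
    rw [show 2 * (n + 1) = 2 * n + 1 + 1 by ring, alternatingWord_succ', alternatingWord_succ']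
    simp [ih, pow_succ', mul_assoc]

theorem leftInvSeq_alternatingWord (i j : B) (n : ℕ) :
    cs.leftInvSeq (alternatingWord i j (2 * n)) =
      (List.range (2 * n)).map fun k => cs.wordProd (alternatingWord j i (2 * k + 1)) := by
  apply List.ext_getElem
  · simp
  · intro k h₁ h₂
    rw [cs.getElem_leftInvSeq_alternatingWord i j n k (by simpa using h₁)]
    simp

-- Since (s_i s_j)^m = 1, the inversion sequence of the word of length 2m is a list of length m
-- written twice.
open Classical in
theorem even_count_leftInvSeq (i j : B) (t : W) :
    Even ((cs.leftInvSeq (alternatingWord i j (2 * M i j))).count t) := by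
  rw [leftInvSeq_alternatingWord, two_mul, List.range_add, List.map_append, List.count_append,
    List.map_map]
  have h : ((fun k => cs.wordProd (alternatingWord j i (2 * k + 1))) ∘ fun x => M i j + x) =
      fun k => cs.wordProd (alternatingWord j i (2 * k + 1)) := by
    funext k
    simp only [Function.comp, prod_alternatingWord_eq_mul_pow]
    have h₁ : (2 * (M i j + k) + 1) / 2 = M i j + k := by omega
    have h₂ : (2 * k + 1) / 2 = k := by omega
    simp [h₁, h₂, pow_add]
  rw [h]
  exact ⟨_, rfl⟩

theorem reverse_alternatingWord (i j : B) (n : ℕ) :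
    (alternatingWord i j (2 * n)).reverse = alternatingWord j i (2 * n) := by
  induction n with
  | zero => simp [alternatingWord]
  | succ n ih =>
    rw [show 2 * (n + 1) = 2 * n + 1 + 1 by ring, alternatingWord_succ', alternatingWord_succ',
      alternatingWord_succ j i, alternatingWord_succ i j]
    simp [ih]

theorem isLiftable_signedConj : M.IsLiftable cs.signedConj := by
  classical
  intro i j
  funext p
  have h := cs.even_count_leftInvSeq j i p.1
  rw [M.symmetric j i, ← reverse_alternatingWord, leftInvSeq_reverse, List.count_reverse] at h
  rw [← map_alternatingWord_prod, prod_map_signedConj]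
  have h₁ : cs.wordProd (alternatingWord i j (2 * M i j)) = 1 := by
    rw [wordProd, map_alternatingWord_prod, simple_mul_simple_pow]
  rw [h₁, (ZMod.natCast_eq_zero_iff_even).2 h]
  simp
  rfl

-- The signed conjugations satisfy the Coxeter relations, so their product depends only on the group
-- element, and with it the parity of each multiplicity.
open Classical in
theorem count_leftInvSeq_congr {ω ω' : List B} (h : cs.wordProd ω = cs.wordProd ω') (t : W) :
    ((cs.leftInvSeq ω).count t : ZMod 2) = (cs.leftInvSeq ω').count t := by
  have key : ∀ ω : List B, (ω.reverse.map cs.signedConj).prod =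
      cs.lift ⟨cs.signedConj, cs.isLiftable_signedConj⟩ (cs.wordProd ω)⁻¹ := by
    intro ω
    rw [← wordProd_reverse, wordProd, map_list_prod, List.map_map]
    congr 2
    funext i
    exact (cs.lift_apply_simple cs.isLiftable_signedConj i).symm
  have h₁ := congrFun (key ω) (t, 0)
  have h₂ := congrFun (key ω') (t, 0)
  rw [h, ← h₂, prod_map_signedConj, prod_map_signedConj] at h₁
  simpa [rightInvSeq_reverse] using (Prod.ext_iff.1 h₁).2

/-- The exchange property. -/
theorem exists_eraseIdx_of_isLeftDescent {ω : List B} {i : B}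
    (h : cs.IsLeftDescent (cs.wordProd ω) i) :
    ∃ j < ω.length, cs.simple i * cs.wordProd ω = cs.wordProd (ω.eraseIdx j) := by
  classical
  obtain ⟨ω', hω', hw⟩ := cs.exists_isReduced (cs.simple i * cs.wordProd ω)
  have h₁ : cs.wordProd (i :: ω') = cs.wordProd ω := by
    rw [wordProd_cons, ← hw, simple_mul_simple_cancel_left]
  have h₂ : cs.simple i ∉ cs.leftInvSeq ω' := by
    intro hmem
    have h₃ := (cs.isLeftInversion_of_mem_leftInvSeq hω' hmem).2
    rw [← hw, simple_mul_simple_cancel_left] at h₃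
    exact absurd h (not_lt.2 h₃.le)
  have h₃ : cs.simple i ∉ (cs.leftInvSeq ω').map (MulAut.conj (cs.simple i)) := by
    intro hmem
    obtain ⟨t, ht, hti⟩ := List.mem_map.1 hmem
    have : t = cs.simple i := by
      apply (MulAut.conj (cs.simple i)).injective
      rw [hti]; simp
    exact h₂ (this ▸ ht)
  -- In the inversion sequence of `i :: ω'` the reflection s_i occurs once, at the head; by parity
  -- it must occur for ω as well, and its position is the letter to erase.
  have h₄ := cs.count_leftInvSeq_congr h₁ (cs.simple i)
  rw [leftInvSeq, List.count_cons_self, List.count_eq_zero_of_not_mem h₃] at h₄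
  have h₅ : cs.simple i ∈ cs.leftInvSeq ω := by
    by_contra hcon
    rw [List.count_eq_zero_of_not_mem hcon] at h₄
    simp at h₄
  obtain ⟨j, hj, hji⟩ := List.mem_iff_getElem.1 h₅
  refine ⟨j, by simpa using hj, ?_⟩
  rw [← getD_leftInvSeq_mul_wordProd, List.getD_eq_getElem _ _ hj, hji]

/-- Exchange in the concatenation of reduced words of u and v: the erased letter lies in one of the
two. -/
theorem length_simple_mul_of_append {u v : W} {i : B}
    (huv : cs.length (u * v) = cs.length u + cs.length v)
    (hi : cs.IsLeftDescent (u * v) i) :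
    (cs.length (cs.simple i * u) < cs.length u) ∨
      ∃ v', cs.length v' < cs.length v ∧ cs.simple i * (u * v) = u * v' := by
  obtain ⟨ω₁, h₁, rfl⟩ := cs.exists_isReduced u
  obtain ⟨ω₂, h₂, rfl⟩ := cs.exists_isReduced v
  rw [← wordProd_append] at hi
  obtain ⟨j, hj, h⟩ := cs.exists_eraseIdx_of_isLeftDescent hi
  by_cases hj₁ : j < ω₁.length
  · left
    rw [List.eraseIdx_append_of_lt_length hj₁, wordProd_append, wordProd_append, ← mul_assoc,
      mul_left_inj] at h
    rw [h, h₁.eq]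
    refine (cs.length_wordProd_le _).trans_lt ?_
    rw [List.length_eraseIdx_of_lt hj₁]
    omega
  · right
    rw [not_lt] at hj₁
    rw [List.eraseIdx_append_of_length_le hj₁, wordProd_append, wordProd_append] at h
    refine ⟨_, ?_, h⟩
    rw [h₂.eq]
    refine (cs.length_wordProd_le _).trans_lt ?_
    rw [List.length_append] at hj
    rw [List.length_eraseIdx_of_lt (by omega)]
    omega

/-- An element with all left descents is longest. -/
theorem length_le_of_forall_isLeftDescent {w : W} (hw : ∀ i, cs.IsLeftDescent w i) (x : W) :
    cs.length w = cs.length x + cs.length (x⁻¹ * w) := by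
  obtain ⟨ω, hω, rfl⟩ := cs.exists_isReduced x
  induction ω with
  | nil => simp
  | cons i ω ih =>
    have hr : cs.IsReduced ω := by simpa using hω.drop 1
    have h := ih hr
    set u := cs.wordProd ω
    have h₁ : cs.length (cs.simple i * u) = cs.length u + 1 := by
      have := hω.eq
      rw [wordProd_cons, List.length_cons] at this
      rw [this, hr.eq]
    rw [wordProd_cons]
    have h₂ : cs.length (u * (u⁻¹ * w)) = cs.length u + cs.length (u⁻¹ * w) := by
      rw [mul_inv_cancel_left]; exact h
    -- As s_i u is longer than u, the erased letter lies in the second factor; the triangle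
    -- inequality then forces additivity for s_i u.
    rcases cs.length_simple_mul_of_append h₂ (i := i) (by rw [mul_inv_cancel_left]; exact hw i)
      with h₃ | ⟨v', hv', h₃⟩
    · omega
    · have h₄ : v' = u⁻¹ * cs.simple i * w := by
        rw [mul_inv_cancel_left] at h₃
        rw [mul_assoc, h₃, inv_mul_cancel_left]
      rw [mul_inv_rev, inv_simple]
      rw [← h₄]
      have h₅ : cs.length w ≤ cs.length (cs.simple i * u) + cs.length v' := by
        have := cs.length_mul_le (cs.simple i * u) v'
        rwa [show cs.simple i * u * v' = w by rw [h₄]; simp [mul_assoc]] at this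
      change cs.length w = cs.length (cs.simple i * u) + cs.length v'
      omega

/-- The subgroup generated by the simple reflections with index in `I`. -/
def standardParabolic (I : Set B) : Subgroup W := Subgroup.closure (cs.simple '' I)

theorem simple_mem_standardParabolic {I : Set B} {i : B} (hi : i ∈ I) :
    cs.simple i ∈ cs.standardParabolic I := Subgroup.subset_closure ⟨i, hi, rfl⟩

/-- Every element of a standard parabolic subgroup either is trivial or has a left descent in it. -/
theorem exists_isLeftDescent_of_mem {I : Set B} {x : W} (hx : x ∈ cs.standardParabolic I)
    (h1 : x ≠ 1) : ∃ i ∈ I, cs.IsLeftDescent x i := by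
  have hword : ∀ x ∈ cs.standardParabolic I,
      ∃ ω : List B, (∀ i ∈ ω, i ∈ I) ∧ cs.wordProd ω = x := by
    intro x hx
    induction hx using Subgroup.closure_induction with
    | mem x hx =>
      obtain ⟨i, hi, rfl⟩ := hx
      exact ⟨[i], by simpa using hi, by simp⟩
    | one => exact ⟨[], by simp, by simp⟩
    | mul x y _ _ hx hy =>
      obtain ⟨ω₁, h₁, rfl⟩ := hx
      obtain ⟨ω₂, h₂, rfl⟩ := hy
      refine ⟨ω₁ ++ ω₂, ?_, by simp [wordProd_append]⟩
      intro i hi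
      rcases List.mem_append.1 hi with h | h
      exacts [h₁ i h, h₂ i h]
    | inv x _ hx =>
      obtain ⟨ω₁, h₁, rfl⟩ := hx
      exact ⟨ω₁.reverse, by simpa using h₁, by simp⟩
  have hred : ∀ n : ℕ, ∀ ω : List B, ω.length = n → (∀ i ∈ ω, i ∈ I) → cs.wordProd ω ≠ 1 →
      ∃ i ∈ I, cs.IsLeftDescent (cs.wordProd ω) i := by
    intro n
    induction n using Nat.strong_induction_on with
    | _ n ih =>
      intro ω hn hI hne
      cases ω with
      | nil => simp at hne
      | cons i ω =>
        by_cases hd : cs.IsLeftDescent (cs.wordProd (i :: ω)) i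
        · exact ⟨i, hI i (by simp), hd⟩
        -- If the first letter is no descent, exchange gives a shorter word in I for the same
        -- element.
        · have hd' : cs.IsLeftDescent (cs.wordProd ω) i := by
            rw [cs.isLeftDescent_iff_not_isLeftDescent_mul, ← wordProd_cons]
            exact hd
          obtain ⟨j, hj, h⟩ := cs.exists_eraseIdx_of_isLeftDescent hd'
          rw [← wordProd_cons] at h
          rw [h] at hne ⊢
          refine ih _ ?_ _ rfl ?_ hne
          · rw [List.length_eraseIdx_of_lt hj]
            simp at hn
            omega
          · intro k hk
            exact hI k (List.mem_cons_of_mem _ (List.mem_of_mem_eraseIdx hk))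
  obtain ⟨ω, hI, rfl⟩ := hword x hx
  exact hred _ ω rfl hI h1

/-- Lengths add in the product of an element of a standard parabolic subgroup and an element
of minimal length in its coset. -/
theorem length_mul_of_forall_le {I : Set B} {y : W}
    (hy : ∀ z ∈ cs.standardParabolic I, cs.length y ≤ cs.length (z * y)) {x : W}
    (hx : x ∈ cs.standardParabolic I) :
    cs.length (x * y) = cs.length x + cs.length y := by
  induction hn : cs.length x generalizing x with
  | zero =>
    rw [cs.length_eq_zero_iff] at hn
    simp [hn]
  | succ n ih =>
    have h1 : x ≠ 1 := by rintro rfl; simp at hn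
    obtain ⟨i, hi, hd⟩ := cs.exists_isLeftDescent_of_mem hx h1
    have hmem : cs.simple i * x ∈ cs.standardParabolic I :=
      mul_mem (cs.simple_mem_standardParabolic hi) hx
    rw [cs.isLeftDescent_iff] at hd
    have h₂ := ih hmem (by omega)
    rw [mul_assoc] at h₂
    rcases cs.length_simple_mul (x * y) i with h₃ | h₃
    swap
    · omega
    exfalso
    have hd' : cs.IsLeftDescent (cs.simple i * x * y) i := by
      rw [IsLeftDescent, mul_assoc, simple_mul_simple_cancel_left]
      omega
    -- An erased letter in s_i x contradicts the choice of i; one in y yields a shorter element of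
    -- the coset of y.
    rcases cs.length_simple_mul_of_append (u := cs.simple i * x) (v := y)
      (by rw [mul_assoc]; omega) hd' with h₄ | ⟨v', hv', h₄⟩
    · rw [simple_mul_simple_cancel_left] at h₄
      omega
    · have h₅ := hy ((cs.simple i * x)⁻¹ * (cs.simple i * (cs.simple i * x)))
        (mul_mem (inv_mem hmem) (mul_mem (cs.simple_mem_standardParabolic hi) hmem))
      rw [show (cs.simple i * x)⁻¹ * (cs.simple i * (cs.simple i * x)) * y = v' by
        rw [mul_assoc, inv_mul_eq_iff_eq_mul, ← h₄]; simp only [mul_assoc]] at h₅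
      omega

/-- The elements without left descent in `I`. -/
def minimalReps (I : Set B) : Set W := {w | ∀ i ∈ I, ¬ cs.IsLeftDescent w i}

theorem exists_mul_eq_minimal (I : Set B) (w : W) :
    ∃ x ∈ cs.standardParabolic I, ∃ y, x * y = w ∧
      ∀ z ∈ cs.standardParabolic I, cs.length y ≤ cs.length (z * y) := by
  have hne : (Set.image (fun z => cs.length (z * w)) (cs.standardParabolic I : Set W)).Nonempty :=
    ⟨_, 1, one_mem _, rfl⟩
  obtain ⟨z₀, hz₀, h₀⟩ := Nat.sInf_mem hne
  refine ⟨z₀⁻¹, inv_mem hz₀, z₀ * w, by simp, ?_⟩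
  intro z hz
  have := Nat.sInf_le (s := Set.image (fun z => cs.length (z * w))
    (cs.standardParabolic I : Set W)) ⟨z * z₀, mul_mem hz hz₀, rfl⟩
  rw [← h₀] at this
  simpa [mul_assoc] using this

/-- Split off the minimal element of the coset: if the parabolic factor were nontrivial, one of its
left descents would be a left descent of y by additivity of lengths. -/
theorem length_le_of_mem_minimalReps {I : Set B} {y : W} (hy : y ∈ cs.minimalReps I) :
    ∀ z ∈ cs.standardParabolic I, cs.length y ≤ cs.length (z * y) := by
  obtain ⟨x, hx, y', rfl, hmin⟩ := cs.exists_mul_eq_minimal I y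
  by_cases h1 : x = 1
  · subst h1; simpa using hmin
  · exfalso
    obtain ⟨i, hi, hd⟩ := cs.exists_isLeftDescent_of_mem hx h1
    apply hy i hi
    have h₁ := cs.length_mul_of_forall_le hmin hx
    have h₂ := cs.length_mul_of_forall_le hmin
      (mul_mem (cs.simple_mem_standardParabolic hi) hx)
    rw [IsLeftDescent] at hd ⊢
    rw [← mul_assoc]
    omega

theorem length_mul_of_mem_minimalReps {I : Set B} {x y : W}
    (hx : x ∈ cs.standardParabolic I) (hy : y ∈ cs.minimalReps I) :
    cs.length (x * y) = cs.length x + cs.length y :=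
  cs.length_mul_of_forall_le (cs.length_le_of_mem_minimalReps hy) hx

/-- Every element is uniquely the product of an element of the parabolic subgroup `W_I` and one
without left descents in `I`. -/
theorem bijective_mul_minimalReps (I : Set B) :
    Function.Bijective fun p : cs.standardParabolic I × cs.minimalReps I => (p.1 : W) * p.2 := by
  constructor
  · rintro ⟨⟨x, hx⟩, y, hy⟩ ⟨⟨x', hx'⟩, y', hy'⟩ h
    dsimp only at h
    have hyy' : y' = x'⁻¹ * x * y := by rw [mul_assoc, h, inv_mul_cancel_left]
    have hz : x'⁻¹ * x ∈ cs.standardParabolic I := mul_mem (inv_mem hx') hx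
    have h₁ := cs.length_mul_of_mem_minimalReps hz hy
    have h₂ := cs.length_le_of_mem_minimalReps hy' _ (inv_mem hz)
    rw [hyy', inv_mul_cancel_left] at h₂
    have h₃ : x'⁻¹ * x = 1 := by rw [← cs.length_eq_zero_iff]; omega
    have h₄ : x = x' := (inv_mul_eq_one.1 h₃).symm
    subst h₄
    have h₅ : y = y' := mul_left_cancel h
    subst h₅
    rfl
  · intro w
    obtain ⟨x, hx, y, rfl, hmin⟩ := cs.exists_mul_eq_minimal I w
    refine ⟨⟨⟨x, hx⟩, y, ?_⟩, rfl⟩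
    intro i hi hd
    exact absurd (hmin _ (cs.simple_mem_standardParabolic hi)) (not_le.2 hd)

end CoxeterSystem

/-! ### Determinant identities in a noncommutative ring. -/

section Algebra

variable {R K : Type*} [Ring R] [CommRing K]

theorem Units.inv_mul_comm_of_comm {b c : R} (hbc : b * c = c * b) (uc : Rˣ)
    (hc : (uc : R) = 1 + c) :
    b * ↑uc⁻¹ = ↑uc⁻¹ * b := by
  have h₁ : (↑uc⁻¹ : R) * (1 + c) = 1 := by rw [← hc]; simp
  have h₂ : (1 + c) * (↑uc⁻¹ : R) = 1 := by rw [← hc]; simp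
  linear_combination (norm := noncomm_ring)
    - h₁ * b * ↑uc⁻¹ + (↑uc⁻¹ : R) * b * h₂ - (↑uc⁻¹ : R) * hbc * ↑uc⁻¹

/-- Reduction of the determinant of `W(u)` to one without inverses of rank-two series in `ab`
and `ac`. -/
theorem det_factorization (d : R →* K) (ua ub uc Wab Wac Wbc W p r : Rˣ) (D : R)
    (hp : Wac = ua * p) (hr : Wab = ua * r)
    (hD : 1 - (↑ub⁻¹ : R) - ↑uc⁻¹ + ↑Wbc⁻¹ = D * ↑Wbc⁻¹)
    (hW : (↑W⁻¹ : R) = 1 - ↑ua⁻¹ - ↑ub⁻¹ - ↑uc⁻¹ + ↑Wab⁻¹ + ↑Wac⁻¹ + ↑Wbc⁻¹) :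
    d (1 - ((p : R) - 1) * ((r : R) - 1) + p * D * ↑Wbc⁻¹ * Wab) * d W * d ua = d Wab * d Wac := by
  -- Since W⁻¹ = D Wbc⁻¹ + (p⁻¹ + r⁻¹ - 1) ua⁻¹, multiplying by p on the left and by ua r on the
  -- right clears every inverse except that of Wbc.
  have h₁ : 1 - ((p : R) - 1) * ((r : R) - 1) + p * D * ↑Wbc⁻¹ * Wab = p * ↑W⁻¹ * ua * r := by
    have e : (↑W⁻¹ : R) = D * ↑Wbc⁻¹ + (↑p⁻¹ + ↑r⁻¹ - 1) * ↑ua⁻¹ := by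
      rw [hW, ← hD, hp, hr]
      simp only [mul_inv_rev, Units.val_mul]
      noncomm_ring
    rw [e, hr]
    have e1 : (↑ua⁻¹ : R) * ua = 1 := by simp
    have e2 : (p : R) * ↑p⁻¹ = 1 := by simp
    have e3 : (↑r⁻¹ : R) * r = 1 := by simp
    rw [Units.val_mul]
    linear_combination (norm := noncomm_ring) - (p : R) * (↑p⁻¹ + ↑r⁻¹ - 1) * e1 * (r : R)
      - e2 * (r : R) - (p : R) * e3
  have hdet : d ↑W⁻¹ * d (W : R) = 1 := by rw [← map_mul]; simp
  rw [h₁, hp, hr]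
  simp only [map_mul, Units.val_mul]
  linear_combination d p * d ua * d r * d ua * hdet

/-- Here p = (1 + ca)(1 + c), and Wab can also be written with 1 + b on the left. These factors
cancel Wbc⁻¹ completely, and the remaining polynomial is (1 - cab)(1 - caba) without any cyclic
move. -/
theorem det_identity_C2 (d : R →* K) {a b c : R} (ua ub uc Wab Wac Wbc W : Rˣ)
    (hbc : b * c = c * b) (hab : a * b * a * b = b * a * b * a)
    (ha : (ua : R) = 1 + a) (hb : (ub : R) = 1 + b) (hc : (uc : R) = 1 + c)
    (hWab : (Wab : R) = (1 + a) * (1 + b + b * a + b * a * b))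
    (hWac : (Wac : R) = (1 + a) * (1 + c + c * a + c * a * c))
    (hWbc : (Wbc : R) = (1 + b) * (1 + c))
    (hW : (↑W⁻¹ : R) = 1 - ↑ua⁻¹ - ↑ub⁻¹ - ↑uc⁻¹ + ↑Wab⁻¹ + ↑Wac⁻¹ + ↑Wbc⁻¹) :
    d Wab * d Wac * d Wbc =
      d W * d ua * d ub * d uc * d (1 - c * a * b * a) * d (1 - c * a * b) := by
  have hWbc' : Wbc = ub * uc := Units.ext (by rw [hWbc, Units.val_mul, hb, hc])
  have hbi := Units.inv_mul_comm_of_comm hbc uc hc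
  have e1 : (↑ub⁻¹ : R) * (1 + b) = 1 := by rw [← hb]; simp
  have e3 : (1 + c) * (↑uc⁻¹ : R) = 1 := by rw [← hc]; simp
  have e4 : (1 + b) * (↑ub⁻¹ : R) = 1 := by rw [← hb]; simp
  have hv : (↑Wbc⁻¹ : R) = ↑uc⁻¹ * ↑ub⁻¹ := by rw [hWbc', mul_inv_rev, Units.val_mul]
  have hp : (↑(ua⁻¹ * Wac) : R) = 1 + c + c * a + c * a * c := by
    rw [Units.val_mul, hWac, ← ha, Units.inv_mul_cancel_left]
  have hr : (↑(ua⁻¹ * Wab) : R) = 1 + b + b * a + b * a * b := by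
    rw [Units.val_mul, hWab, ← ha, Units.inv_mul_cancel_left]
  have hD : 1 - (↑ub⁻¹ : R) - ↑uc⁻¹ + ↑Wbc⁻¹ = (b * c) * ↑Wbc⁻¹ := by
    rw [hv]
    linear_combination (norm := noncomm_ring) - (1 + b) * e3 * ↑ub⁻¹ + e3 * ↑ub⁻¹ - e4
      + hbi * ↑ub⁻¹ + (↑uc⁻¹ : R) * e4
  have key := det_factorization d ua ub uc Wab Wac Wbc W _ _ _
    (mul_inv_cancel_left ua Wac).symm (mul_inv_cancel_left ua Wab).symm hD hW
  rw [hp, hr] at key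
  have h₁ : (1 + c + c * a + c * a * c) * (b * c) * ↑Wbc⁻¹ * Wab =
      (c + c * a * c) * b * (1 + a + a * b + a * b * a) := by
    have e : (1 + c + c * a + c * a * c) * (b * c) * (↑uc⁻¹ * ↑ub⁻¹) * (1 + b) =
        (c + c * a * c) * b := by
      calc _ = (1 + c * a) * ((1 + c) * (b * c * ↑uc⁻¹)) * (↑ub⁻¹ * (1 + b)) := by noncomm_ring
        _ = (1 + c * a) * (b * c) * ((1 + c) * ↑uc⁻¹) := by
          rw [e1]
          linear_combination (norm := noncomm_ring) - (1 + c * a) * hbc * c * ↑uc⁻¹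
        _ = _ := by
          rw [e3]; linear_combination (norm := noncomm_ring) (1 + c * a) * hbc
    rw [hWab, hv, show (1 + a) * (1 + b + b * a + b * a * b) =
      (1 + b) * (1 + a + a * b + a * b * a) by
        linear_combination (norm := noncomm_ring) hab, ← mul_assoc, e]
  have h₂ : 1 - (1 + c + c * a + c * a * c - 1) * (1 + b + b * a + b * a * b - 1) +
      (1 + c + c * a + c * a * c) * (b * c) * ↑Wbc⁻¹ * Wab =
      (1 - c * a * b) * (1 - c * a * b * a) := by
    rw [h₁]
    linear_combination (norm := noncomm_ring) - c * hab - c * a * hbc * a * b * a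
  rw [h₂, map_mul] at key
  rw [← key, hWbc', Units.val_mul, map_mul]
  ring

/-- The factor 1 + b of Wab cancels ub⁻¹, but one inverse of 1 + c survives inside a product. The
cyclic move brings it to the right end, where multiplication by 1 + c removes it and the polynomial
factors. -/
theorem det_identity_G2 (d : R →* K) (hd : ∀ x y, d (1 - x * y) = d (1 - y * x))
    {a b c : R} (ua ub uc Wab Wac Wbc W : Rˣ)
    (hbc : b * c = c * b) (hac : a * c * a = c * a * c)
    (hab : a * b * a * b * a * b = b * a * b * a * b * a)
    (ha : (ua : R) = 1 + a) (hb : (ub : R) = 1 + b) (hc : (uc : R) = 1 + c)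
    (hWab : (Wab : R) = (1 + a) * (1 + b + b * a + b * a * b + b * a * b * a + b * a * b * a * b))
    (hWac : (Wac : R) = (1 + a) * (1 + c + c * a))
    (hWbc : (Wbc : R) = (1 + b) * (1 + c))
    (hW : (↑W⁻¹ : R) = 1 - ↑ua⁻¹ - ↑ub⁻¹ - ↑uc⁻¹ + ↑Wab⁻¹ + ↑Wac⁻¹ + ↑Wbc⁻¹) :
    d Wab * d Wac * d Wbc =
      d W * d ua * d ub * d uc * d (1 - c * a * b) * d (1 - c * a * b * a * b) := by
  have hWbc' : Wbc = ub * uc := Units.ext (by rw [hWbc, Units.val_mul, hb, hc])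
  have hbi := Units.inv_mul_comm_of_comm hbc uc hc
  have e1 : (↑ub⁻¹ : R) * (1 + b) = 1 := by rw [← hb]; simp
  have e2 : (↑uc⁻¹ : R) * (1 + c) = 1 := by rw [← hc]; simp
  have e3 : (1 + c) * (↑uc⁻¹ : R) = 1 := by rw [← hc]; simp
  have e4 : (1 + b) * (↑ub⁻¹ : R) = 1 := by rw [← hb]; simp
  have hv : (↑Wbc⁻¹ : R) = ↑uc⁻¹ * ↑ub⁻¹ := by rw [hWbc', mul_inv_rev, Units.val_mul]
  have hp : (↑(ua⁻¹ * Wac) : R) = 1 + c + c * a := by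
    rw [Units.val_mul, hWac, ← ha, Units.inv_mul_cancel_left]
  have hr : (↑(ua⁻¹ * Wab) : R) =
      1 + b + b * a + b * a * b + b * a * b * a + b * a * b * a * b := by
    rw [Units.val_mul, hWab, ← ha, Units.inv_mul_cancel_left]
  have hD : 1 - (↑ub⁻¹ : R) - ↑uc⁻¹ + ↑Wbc⁻¹ = (b * c) * ↑Wbc⁻¹ := by
    rw [hv]
    linear_combination (norm := noncomm_ring) - (1 + b) * e3 * ↑ub⁻¹ + e3 * ↑ub⁻¹ - e4
      + hbi * ↑ub⁻¹ + (↑uc⁻¹ : R) * e4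
  have key := det_factorization d ua ub uc Wab Wac Wbc W _ _ _
    (mul_inv_cancel_left ua Wac).symm (mul_inv_cancel_left ua Wab).symm hD hW
  rw [hp, hr] at key
  -- E is what remains after c a uc⁻¹ b is split off from the left.
  set E := 1 + a + a * b + a * b * a - c * a * b * a * b - c * a * b * a * b * a with hE
  have h₁ : (1 + c + c * a) * (b * c) * ↑Wbc⁻¹ * Wab = (c * b + c * a * b - c * a * b * ↑uc⁻¹) *
      (1 + a + a * b + a * b * a + a * b * a * b + a * b * a * b * a) := by
    have e : (1 + c + c * a) * (b * c) * (↑uc⁻¹ * ↑ub⁻¹) * (1 + b) =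
        c * b + c * a * b - c * a * b * ↑uc⁻¹ := by
      calc _ = (1 + c + c * a) * (b * c) * ↑uc⁻¹ * (↑ub⁻¹ * (1 + b)) := by noncomm_ring
        _ = _ := by
          rw [e1]
          linear_combination (norm := noncomm_ring) - hbc * c * ↑uc⁻¹ + b * c * e3 + hbc
            + c * a * b * e3
    rw [hWab, hv, show (1 + a) *
      (1 + b + b * a + b * a * b + b * a * b * a + b * a * b * a * b) =
      (1 + b) * (1 + a + a * b + a * b * a + a * b * a * b + a * b * a * b * a) by
        linear_combination (norm := noncomm_ring) hab, ← mul_assoc, e]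
  have h₂ : 1 - (1 + c + c * a - 1) *
      (1 + b + b * a + b * a * b + b * a * b * a + b * a * b * a * b - 1) +
      (1 + c + c * a) * (b * c) * ↑Wbc⁻¹ * Wab = 1 - (c * a * ↑uc⁻¹) * (b * E) := by
    rw [h₁]
    clear_value E
    subst hE
    linear_combination (norm := noncomm_ring) - c * hab - c * a * hbi *
      (1 + a + a * b + a * b * a - c * a * b * a * b - c * a * b * a * b * a)
        - c * a * b * e2 * (a * b * a * b + a * b * a * b * a)
  have h₃ : 1 - (b * E) * (c * a * ↑uc⁻¹) = (1 - b * c * a) * (1 - b * a * b * c * a) := by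
    have h : 1 + c - b * E * (c * a) = (1 - b * c * a) * (1 - b * a * b * c * a) * (1 + c) := by
      rw [hE]
      linear_combination (norm := noncomm_ring)
        - b * hac - b * a * b * hac + b * c * a * b * a * b * hac
    linear_combination (norm := noncomm_ring) h * (↑uc⁻¹ : R) - e3 +
      (1 - b * c * a) * (1 - b * a * b * c * a) * e3
  rw [h₂, hd, h₃, map_mul] at key
  have h₄ : d (1 - b * c * a) = d (1 - c * a * b) := by
    rw [mul_assoc, hd]
  have h₅ : d (1 - b * a * b * c * a) = d (1 - c * a * b * a * b) := by
    rw [show b * a * b * c * a = (b * a * b) * (c * a) by noncomm_ring, hd]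
    simp only [mul_assoc]
  rw [h₄, h₅] at key
  rw [← key, hWbc', Units.val_mul, map_mul]
  ring

/-- The factor 1 - cab splits off directly. The other one still contains z⁻¹ with z = 1 + c + cb; a
cyclic move brings z⁻¹ to the left, and multiplication by z leaves (1 - acb)(1 + c). -/
theorem det_identity_A2 (d : R →* K) (hd : ∀ x y, d (1 - x * y) = d (1 - y * x))
    {a b c : R} (ua ub uc Wab Wac Wbc W : Rˣ)
    (hab : a * b * a = b * a * b) (hbc : b * c * b = c * b * c)
    (ha : (ua : R) = 1 + a) (hb : (ub : R) = 1 + b) (hc : (uc : R) = 1 + c)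
    (hWab : (Wab : R) = (1 + a) * (1 + b + b * a))
    (hWac : (Wac : R) = (1 + a) * (1 + c + c * a))
    (hWbc : (Wbc : R) = (1 + b) * (1 + c + c * b))
    (hW : (↑W⁻¹ : R) = 1 - ↑ua⁻¹ - ↑ub⁻¹ - ↑uc⁻¹ + ↑Wab⁻¹ + ↑Wac⁻¹ + ↑Wbc⁻¹) :
    d Wab * d Wac * d Wbc =
      d W * d ua * d ub * d uc * d (1 - c * b * a) * d (1 - c * a * b) := by
  set z : Rˣ := ub⁻¹ * Wbc with hz
  have hWbc' : Wbc = ub * z := by rw [hz, mul_inv_cancel_left]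
  have hzv : (z : R) = 1 + c + c * b := by
    rw [hz, Units.val_mul, hWbc, ← hb, Units.inv_mul_cancel_left]
  have e1 : (↑ub⁻¹ : R) * (1 + b) = 1 := by rw [← hb]; simp
  have e2 : (↑uc⁻¹ : R) * (1 + c) = 1 := by rw [← hc]; simp
  have e5 : (1 + c + c * b) * (↑z⁻¹ : R) = 1 := by rw [← hzv]; simp
  have hv : (↑Wbc⁻¹ : R) = ↑z⁻¹ * ↑ub⁻¹ := by rw [hWbc', mul_inv_rev, Units.val_mul]
  have hp : (↑(ua⁻¹ * Wac) : R) = 1 + c + c * a := by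
    rw [Units.val_mul, hWac, ← ha, Units.inv_mul_cancel_left]
  have hr : (↑(ua⁻¹ * Wab) : R) = 1 + b + b * a := by
    rw [Units.val_mul, hWab, ← ha, Units.inv_mul_cancel_left]
  -- Inclusion-exclusion in the finite dihedral group: only the longest element bcb has both left
  -- descents.
  have hD : 1 - (↑ub⁻¹ : R) - ↑uc⁻¹ + ↑Wbc⁻¹ = (b * c * b) * ↑Wbc⁻¹ := by
    have h : (1 - (↑ub⁻¹ : R) - ↑uc⁻¹) * Wbc + 1 = b * c * b := by
      rw [hWbc]
      linear_combination (norm := noncomm_ring) - e1 * (1 + c + c * b) - e2 * (1 + b + b * c)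
        - (↑uc⁻¹ : R) * hbc
    rw [← h, add_mul, one_mul, Units.mul_inv_cancel_right]
  have key := det_factorization d ua ub uc Wab Wac Wbc W _ _ _
    (mul_inv_cancel_left ua Wac).symm (mul_inv_cancel_left ua Wab).symm hD hW
  rw [hp, hr] at key
  have h₁ : (1 + c + c * a) * (b * c * b) * ↑Wbc⁻¹ * Wab =
      (1 + c + c * a) * (b * c * b) * ↑z⁻¹ * (1 + a + a * b) := by
    rw [hWab, hv, show (1 + a) * (1 + b + b * a) = (1 + b) * (1 + a + a * b) by
        linear_combination (norm := noncomm_ring) hab]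
    linear_combination (norm := noncomm_ring)
      (1 + c + c * a) * (b * c * b) * ↑z⁻¹ * e1 * (1 + a + a * b)
  have h₂ : 1 - (1 + c + c * a - 1) * (1 + b + b * a - 1) +
      (1 + c + c * a) * (b * c * b) * ↑Wbc⁻¹ * Wab =
      (1 - c * a * b) * (1 - c * b * (↑z⁻¹ * (1 + a + a * b))) := by
    rw [h₁]
    linear_combination (norm := noncomm_ring) c * b * e5 * (1 + a + a * b)
      + hbc * (↑z⁻¹ : R) * (1 + a + a * b) - c * hab
  have h₃ : d (1 - c * b * (↑z⁻¹ * (1 + a + a * b))) * d z = d (1 - c * b * a) * d uc := by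
    rw [hd, mul_comm, ← map_mul, show (z : R) * (1 - ↑z⁻¹ * (1 + a + a * b) * (c * b)) =
        (1 - a * (c * b)) * uc by
      rw [hc, hzv]
      linear_combination (norm := noncomm_ring) - e5 * (1 + a + a * b) * (c * b) - a * hbc,
      map_mul, hd]
  rw [h₂, map_mul] at key
  rw [← key, hWbc', Units.val_mul, map_mul]
  linear_combination d W * d ua * d ub * d (1 - c * a * b) * h₃

end Algebra

/-! ### Lower bounds for the length from an action. -/

namespace CoxeterSystem

section LengthBound

variable {B : Type*} {M : CoxeterMatrix B} {W : Type*} [Group W] (cs : CoxeterSystem M W)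
  {X : Type*} {f : B → X → X} {L : X → ℕ} {x₀ : X}

/-- Maps that satisfy the Coxeter relations define an action of the Coxeter group. -/
theorem foldr_eq_of_wordProd_eq (hf : ∀ i j x, (f i ∘ f j)^[M i j] x = x) {ω ω' : List B}
    (h : cs.wordProd ω = cs.wordProd ω') (x : X) : ω.foldr f x = ω'.foldr f x := by
  let F : B → Function.End X := f
  have hF : M.IsLiftable F := by
    have key : ∀ (g : Function.End X) (n : ℕ), g ^ n = (g : X → X)^[n] := by
      intro g n
      induction n with
      | zero => rfl
      | succ n ih => rw [pow_succ, ih]; rfl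
    intro i j
    rw [key]
    funext x
    exact hf i j x
  have h₁ : ∀ ω : List B, (cs.lift ⟨F, hF⟩ (cs.wordProd ω) : X → X) x = ω.foldr f x := by
    intro ω
    induction ω with
    | nil => rw [wordProd_nil, map_one]; rfl
    | cons i ω ih =>
      have h₂ : cs.lift ⟨F, hF⟩ (cs.wordProd (i :: ω)) = F i * cs.lift ⟨F, hF⟩ (cs.wordProd ω) := by
        rw [wordProd_cons, map_mul, lift_apply_simple]
      rw [List.foldr_cons, ← ih, h₂]
      rfl
  rw [← h₁, ← h₁, h]

/-- The endpoint depends only on the group element, so it may be reached along a reduced word, each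
letter of which raises L by at most one. -/
theorem le_length_wordProd (hf : ∀ i j x, (f i ∘ f j)^[M i j] x = x) (h₀ : L x₀ = 0)
    (hL : ∀ i x, L (f i x) ≤ L x + 1) (ω : List B) :
    L (ω.foldr f x₀) ≤ cs.length (cs.wordProd ω) := by
  obtain ⟨ω', hω', h⟩ := cs.exists_isReduced (cs.wordProd ω)
  rw [cs.foldr_eq_of_wordProd_eq hf h, h, hω'.eq]
  clear h hω'
  induction ω' with
  | nil => exact h₀.le
  | cons i ω' ih => exact (hL i _).trans (by simpa using ih)

theorem isReduced_of_le (hf : ∀ i j x, (f i ∘ f j)^[M i j] x = x) (h₀ : L x₀ = 0)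
    (hL : ∀ i x, L (f i x) ≤ L x + 1) {ω : List B} (h : ω.length ≤ L (ω.foldr f x₀)) :
    cs.IsReduced ω :=
  le_antisymm (cs.length_wordProd_le ω) (h.trans (cs.le_length_wordProd hf h₀ hL ω))

/-- On the invariant set C the word ω raises L by its full length, so all concatenations of copies
of ω are reduced. -/
theorem length_pow_wordProd (hf : ∀ i j x, (f i ∘ f j)^[M i j] x = x) (h₀ : L x₀ = 0)
    (hL : ∀ i x, L (f i x) ≤ L x + 1) {ω : List B} (C : Set X) (hC₀ : x₀ ∈ C)
    (hC : ∀ x ∈ C, ω.foldr f x ∈ C ∧ L (ω.foldr f x) = L x + ω.length) (n : ℕ) :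
    cs.length (cs.wordProd ω ^ n) = n * ω.length := by
  have key : ∃ ω' : List B, cs.wordProd ω' = cs.wordProd ω ^ n ∧ ω'.length = n * ω.length ∧
      ω'.foldr f x₀ ∈ C ∧ L (ω'.foldr f x₀) = n * ω.length := by
    induction n with
    | zero => exact ⟨[], by simp, by simp, hC₀, by simpa using h₀⟩
    | succ n ih =>
      obtain ⟨ω', h₁, h₂, h₃, h₄⟩ := ih
      refine ⟨ω ++ ω', ?_, ?_, ?_, ?_⟩
      · rw [wordProd_append, h₁, pow_succ']
      · rw [List.length_append, h₂]; ring
      · rw [List.foldr_append]; exact (hC _ h₃).1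
      · rw [List.foldr_append, (hC _ h₃).2, h₄]; ring
  obtain ⟨ω', h₁, h₂, h₃, h₄⟩ := key
  rw [← h₁, ← h₂]
  exact cs.isReduced_of_le hf h₀ hL (by rw [h₂, h₄])

end LengthBound

end CoxeterSystem

/-! ### Alcoves encoded by the integer parts of the positive roots. -/

section Floors

/-- The action of the simple reflections of type `A₂` on the vectors of integer parts of the
positive roots `α₁, α₂, α₁ + α₂`. -/
def floorActionA2 : Fin 3 → (ℤ × ℤ × ℤ) → (ℤ × ℤ × ℤ)
  | 0 => fun (x, y, z) => (-x - 1, z, y)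
  | 1 => fun (x, y, z) => (z, -y - 1, x)
  | 2 => fun (x, y, z) => (-y, -x, 1 - z)

/-- The number of separating hyperplanes. -/
def floorLengthA2 : ℤ × ℤ × ℤ → ℕ := fun (x, y, z) => x.natAbs + y.natAbs + z.natAbs

/-- The action of the simple reflections of type `C₂` on the vectors of integer parts of the
two long and the two short positive roots. -/
def floorActionC2 : Fin 3 → (ℤ × ℤ × ℤ × ℤ) → (ℤ × ℤ × ℤ × ℤ)
  | 0 => fun (x, y, p, r) => (y, x, -p - 1, r)
  | 1 => fun (x, y, p, r) => (x, -y - 1, r, p)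
  | 2 => fun (x, y, p, r) => (1 - x, y, -r, -p)

/-- The number of separating hyperplanes. -/
def floorLengthC2 : ℤ × ℤ × ℤ × ℤ → ℕ := fun (x, y, p, r) =>
  x.natAbs + y.natAbs + p.natAbs + r.natAbs

/-- The action of the simple reflections of type `G₂` on the vectors of integer parts of the
positive roots `α₂, α₁, α₁ + α₂, α₁ + 2α₂, α₁ + 3α₂, 2α₁ + 3α₂`, with `α₁` long. -/
def floorActionG2 : Fin 3 → (ℤ × ℤ × ℤ × ℤ × ℤ × ℤ) → (ℤ × ℤ × ℤ × ℤ × ℤ × ℤ)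
  | 0 => fun (x, y, p, r, s, t) => (p, -y - 1, x, r, t, s)
  | 1 => fun (x, y, p, r, s, t) => (-x - 1, s, r, p, y, t)
  | 2 => fun (x, y, p, r, s, t) => (x, -s, -r, -p, -y, 1 - t)

/-- The number of separating hyperplanes. -/
def floorLengthG2 : ℤ × ℤ × ℤ × ℤ × ℤ × ℤ → ℕ := fun (x, y, p, r, s, t) =>
  x.natAbs + y.natAbs + p.natAbs + r.natAbs + s.natAbs + t.natAbs

/-- Inside alcoves, reflection in α = 0 sends ⌊α⌋ = n to -n - 1, and reflection in the wall θ = 1 of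
the highest root sends ⌊θ⌋ = n to 1 - n. The relations hold formally on all integer vectors, so the
vectors that come from alcoves need not be singled out. -/
theorem floorActionA2_relation (i j : Fin 3) (x) :
    (floorActionA2 i ∘ floorActionA2 j)^[AffineType.A2.coxeterMatrix i j] x = x := by
  obtain ⟨x, y, z⟩ := x
  fin_cases i <;> fin_cases j <;>
    simp [AffineType.coxeterMatrix, floorActionA2]

theorem floorActionC2_relation (i j : Fin 3) (x) :
    (floorActionC2 i ∘ floorActionC2 j)^[AffineType.C2.coxeterMatrix i j] x = x := by
  obtain ⟨x, y, p, r⟩ := x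
  fin_cases i <;> fin_cases j <;>
    simp [AffineType.coxeterMatrix, floorActionC2]

theorem floorActionG2_relation (i j : Fin 3) (x) :
    (floorActionG2 i ∘ floorActionG2 j)^[AffineType.G2.coxeterMatrix i j] x = x := by
  obtain ⟨x, y, p, r, s, t⟩ := x
  fin_cases i <;> fin_cases j <;>
    simp [AffineType.coxeterMatrix, floorActionG2]

/-- A generator permutes all coordinates but one up to sign, and changes the absolute value of the
remaining one by at most 1. -/
theorem floorLengthA2_le (i : Fin 3) (x : ℤ × ℤ × ℤ) :
    floorLengthA2 (floorActionA2 i x) ≤ floorLengthA2 x + 1 := by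
  obtain ⟨x, y, z⟩ := x
  fin_cases i <;> simp only [floorLengthA2, floorActionA2] <;> omega

theorem floorLengthC2_le (i : Fin 3) (x : ℤ × ℤ × ℤ × ℤ) :
    floorLengthC2 (floorActionC2 i x) ≤ floorLengthC2 x + 1 := by
  obtain ⟨x, y, p, r⟩ := x
  fin_cases i <;> simp only [floorLengthC2, floorActionC2] <;> omega

theorem floorLengthG2_le (i : Fin 3) (x : ℤ × ℤ × ℤ × ℤ × ℤ × ℤ) :
    floorLengthG2 (floorActionG2 i x) ≤ floorLengthG2 x + 1 := by
  obtain ⟨x, y, p, r, s, t⟩ := x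
  fin_cases i <;> simp only [floorLengthG2, floorActionG2] <;> omega

end Floors

/-! ### Straightness of the strip elements. -/

section Lengths

variable {W : Type*} [Group W]

/-- A reduced word for the element `w₁`. -/
def stripWord₁ : AffineType → List (Fin 3)
  | .A2 => [2, 1, 0]
  | .C2 => [2, 0, 1, 0]
  | .G2 => [2, 0, 1]

/-- A reduced word for the element `w₂`. -/
def stripWord₂ : AffineType → List (Fin 3)
  | .A2 => [2, 0, 1]
  | .C2 => [2, 0, 1]
  | .G2 => [2, 0, 1, 0, 1]

theorem wordProd_stripWord₁ (T : AffineType) (cs : CoxeterSystem T.coxeterMatrix W) :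
    cs.wordProd (stripWord₁ T) = stripElement₁ T cs := by
  cases T <;> simp [stripWord₁, stripElement₁, CoxeterSystem.wordProd, mul_assoc]

theorem wordProd_stripWord₂ (T : AffineType) (cs : CoxeterSystem T.coxeterMatrix W) :
    cs.wordProd (stripWord₂ T) = stripElement₂ T cs := by
  cases T <;> simp [stripWord₂, stripElement₂, CoxeterSystem.wordProd, mul_assoc]

/-- The coordinate pinned to 0 in each cone belongs to the root β whose strip 0 < β < 1 contains the
alcoves w₁ⁿA, with A the base alcove. The other coordinates keep their signs, so their absolute
values are linear on the cone. -/
theorem length_stripElement₁_pow (T : AffineType) (cs : CoxeterSystem T.coxeterMatrix W) (n : ℕ) :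
    cs.length (stripElement₁ T cs ^ n) = n * (stripWord₁ T).length := by
  rw [← wordProd_stripWord₁]
  cases T
  · refine cs.length_pow_wordProd floorActionA2_relation (L := floorLengthA2) (x₀ := (0, 0, 0))
      rfl floorLengthA2_le {x | 0 ≤ x.1 ∧ x.2.1 = 0 ∧ 0 ≤ x.2.2} (by simp) ?_ n
    rintro ⟨x, y, z⟩ ⟨h₁, h₂, h₃⟩
    simp only [stripWord₁, List.foldr, floorActionA2, floorLengthA2, Set.mem_ofPred_eq,
      List.length] at *
    omega
  · refine cs.length_pow_wordProd floorActionC2_relation (L := floorLengthC2)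
      (x₀ := (0, 0, 0, 0)) rfl floorLengthC2_le
      {x | 0 ≤ x.1 ∧ x.2.1 = 0 ∧ 0 ≤ x.2.2.1 ∧ 0 ≤ x.2.2.2} (by simp) ?_ n
    rintro ⟨x, y, p, r⟩ ⟨h₁, h₂, h₃, h₄⟩
    simp only [stripWord₁, List.foldr, floorActionC2, floorLengthC2, Set.mem_ofPred_eq,
      List.length] at *
    omega
  · refine cs.length_pow_wordProd floorActionG2_relation (L := floorLengthG2)
      (x₀ := (0, 0, 0, 0, 0, 0)) rfl floorLengthG2_le
      {x | 0 ≤ x.1 ∧ x.2.1 ≤ 0 ∧ x.2.2.1 = 0 ∧ 0 ≤ x.2.2.2.1 ∧ 0 ≤ x.2.2.2.2.1 ∧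
        0 ≤ x.2.2.2.2.2} (by simp) ?_ n
    rintro ⟨x, y, p, r, s, t⟩ ⟨h₁, h₂, h₃, h₄, h₅, h₆⟩
    simp only [stripWord₁, List.foldr, floorActionG2, floorLengthG2, Set.mem_ofPred_eq,
      List.length] at *
    omega

theorem length_stripElement₂_pow (T : AffineType) (cs : CoxeterSystem T.coxeterMatrix W) (n : ℕ) :
    cs.length (stripElement₂ T cs ^ n) = n * (stripWord₂ T).length := by
  rw [← wordProd_stripWord₂]
  cases T
  · refine cs.length_pow_wordProd floorActionA2_relation (L := floorLengthA2) (x₀ := (0, 0, 0))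
      rfl floorLengthA2_le {x | x.1 = 0 ∧ 0 ≤ x.2.1 ∧ 0 ≤ x.2.2} (by simp) ?_ n
    rintro ⟨x, y, z⟩ ⟨h₁, h₂, h₃⟩
    simp only [stripWord₂, List.foldr, floorActionA2, floorLengthA2, Set.mem_ofPred_eq,
      List.length] at *
    omega
  · refine cs.length_pow_wordProd floorActionC2_relation (L := floorLengthC2)
      (x₀ := (0, 0, 0, 0)) rfl floorLengthC2_le
      {x | 0 ≤ x.1 ∧ 0 ≤ x.2.1 ∧ x.2.2.1 = 0 ∧ 0 ≤ x.2.2.2} (by simp) ?_ n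
    rintro ⟨x, y, p, r⟩ ⟨h₁, h₂, h₃, h₄⟩
    simp only [stripWord₂, List.foldr, floorActionC2, floorLengthC2, Set.mem_ofPred_eq,
      List.length] at *
    omega
  · refine cs.length_pow_wordProd floorActionG2_relation (L := floorLengthG2)
      (x₀ := (0, 0, 0, 0, 0, 0)) rfl floorLengthG2_le
      {x | 0 ≤ x.1 ∧ x.2.1 = 0 ∧ 0 ≤ x.2.2.1 ∧ 0 ≤ x.2.2.2.1 ∧ 0 ≤ x.2.2.2.2.1 ∧
        0 ≤ x.2.2.2.2.2} (by simp) ?_ n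
    rintro ⟨x, y, p, r, s, t⟩ ⟨h₁, h₂, h₃, h₄, h₅, h₆⟩
    simp only [stripWord₂, List.foldr, floorActionG2, floorLengthG2, Set.mem_ofPred_eq,
      List.length] at *
    omega

/-- Moving the base alcove by a braid word crosses m_ij hyperplanes, a finite check. -/
theorem isReduced_braidWord (T : AffineType) (cs : CoxeterSystem T.coxeterMatrix W) (i j : Fin 3)
    (hij : i ≠ j) : cs.IsReduced (CoxeterSystem.braidWord T.coxeterMatrix i j) := by
  cases T
  · refine cs.isReduced_of_le floorActionA2_relation (L := floorLengthA2) (x₀ := (0, 0, 0))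
      rfl floorLengthA2_le ?_
    revert i j
    decide
  · refine cs.isReduced_of_le floorActionC2_relation (L := floorLengthC2)
      (x₀ := (0, 0, 0, 0)) rfl floorLengthC2_le ?_
    revert i j
    decide
  · refine cs.isReduced_of_le floorActionG2_relation (L := floorLengthG2)
      (x₀ := (0, 0, 0, 0, 0, 0)) rfl floorLengthG2_le ?_
    revert i j
    decide

end Lengths

/-! ### Products and sums of twisted Poincaré series. -/

section Series

variable {B : Type*} {M : CoxeterMatrix B} {W : Type*} [Group W] {k : Type*} [Field k]
  (cs : CoxeterSystem M W) {q : k} {V : Type*} [AddCommGroup V] [Module k V]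
  (ρ : HeckeAlgebra cs q →ₐ[k] Module.End k V)

theorem HeckeAlgebra.e_one : HeckeAlgebra.e cs q 1 = 1 :=
  (RingQuot.mkAlgHom_rel k (HeckeRel.one (cs := cs) (q := q))).trans (map_one _)

theorem HeckeAlgebra.e_mul {w v : W} (h : cs.length (w * v) = cs.length w + cs.length v) :
    HeckeAlgebra.e cs q (w * v) = HeckeAlgebra.e cs q w * HeckeAlgebra.e cs q v :=
  ((map_mul _ _ _).symm.trans (RingQuot.mkAlgHom_rel k (HeckeRel.mul w v h))).symm

/-- The term `ρ(e_w) u^{ℓ(w)}` of the twisted Poincaré series. -/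
noncomputable def heckeTerm (w : W) : PowerSeries (Module.End k V) :=
  monomial (cs.length w) (ρ (HeckeAlgebra.e cs q w))

theorem heckeTerm_one : heckeTerm cs ρ 1 = 1 := by
  rw [heckeTerm, HeckeAlgebra.e_one, cs.length_one, map_one]
  exact monomial_zero_eq_C_apply _

theorem heckeTerm_mul {w v : W} (h : cs.length (w * v) = cs.length w + cs.length v) :
    heckeTerm cs ρ (w * v) = heckeTerm cs ρ w * heckeTerm cs ρ v := by
  rw [heckeTerm, HeckeAlgebra.e_mul cs h, h, map_mul, heckeTerm, heckeTerm, monomial_mul_monomial]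

theorem heckeTerm_wordProd {ω : List B} (hω : cs.IsReduced ω) :
    heckeTerm cs ρ (cs.wordProd ω) = (ω.map fun i => heckeTerm cs ρ (cs.simple i)).prod := by
  induction ω with
  | nil => simpa using heckeTerm_one cs ρ
  | cons i ω ih =>
    have hr : cs.IsReduced ω := by simpa using hω.drop 1
    have h := hω.eq
    rw [CoxeterSystem.wordProd_cons, List.length_cons] at h
    rw [CoxeterSystem.wordProd_cons, heckeTerm_mul, ih hr, List.map_cons, List.prod_cons]
    rw [h, hr.eq, cs.length_simple, add_comm]

variable [Finite B]

-- Summing over all elements of length n with an indicator allows series of different sets to be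
-- compared term by term.
open Classical in
theorem coeff_twistedPoincare (D : Set W) (n : ℕ) :
    coeff n (twistedPoincare cs ρ D) = ∑ w ∈ (cs.finite_length_eq Set.univ n).toFinset,
      if w ∈ D then ρ (HeckeAlgebra.e cs q w) else 0 := by
  rw [twistedPoincare, coeff_mk, ← Finset.sum_filter]
  congr 1
  ext w
  simp [and_comm]

theorem twistedPoincare_union {D₁ D₂ : Set W} (h : Disjoint D₁ D₂) :
    twistedPoincare cs ρ (D₁ ∪ D₂) = twistedPoincare cs ρ D₁ + twistedPoincare cs ρ D₂ := by
  classical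
  ext1 n
  rw [map_add, coeff_twistedPoincare, coeff_twistedPoincare, coeff_twistedPoincare,
    ← Finset.sum_add_distrib]
  refine Finset.sum_congr rfl fun w _ => ?_
  have := fun h₁ : w ∈ D₁ => Set.disjoint_left.1 h h₁
  by_cases h₁ : w ∈ D₁ <;> by_cases h₂ : w ∈ D₂ <;> simp_all

theorem twistedPoincare_image {ι : Type*} (s : Finset ι) (g : ι → W) (hg : Set.InjOn g s) :
    twistedPoincare cs ρ (g '' s) = ∑ x ∈ s, heckeTerm cs ρ (g x) := by
  classical
  ext1 n
  rw [map_sum, twistedPoincare, coeff_mk]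
  have h : (cs.finite_length_eq (g '' s) n).toFinset =
      (s.filter fun x => cs.length (g x) = n).image g := by
    ext w
    simp only [Set.Finite.mem_toFinset, Set.mem_ofPred_eq, Set.mem_image, Finset.mem_coe,
      Finset.mem_image, Finset.mem_filter]
    constructor
    · rintro ⟨⟨x, hx, rfl⟩, h⟩; exact ⟨x, ⟨hx, h⟩, rfl⟩
    · rintro ⟨x, ⟨hx, h⟩, rfl⟩; exact ⟨⟨x, hx, rfl⟩, h⟩
  rw [h, Finset.sum_image, Finset.sum_filter]
  · refine Finset.sum_congr rfl fun x _ => ?_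
    rw [heckeTerm, coeff_monomial]
    simp only [eq_comm]
  · intro x hx y hy hxy
    simp only [Finset.coe_filter, Set.mem_ofPred_eq] at hx hy
    exact hg hx.1 hy.1 hxy

theorem twistedPoincare_singleton (w : W) :
    twistedPoincare cs ρ {w} = heckeTerm cs ρ w := by
  have := twistedPoincare_image cs ρ {()} (fun _ => w) (by simp)
  simpa using this

/-- The Cauchy product runs over pairs (x, y) with ℓ(x) + ℓ(y) = n, which multiplication matches
with the elements of D of length n. -/
theorem twistedPoincare_mul {D₁ D₂ D : Set W}
    (hD : Set.BijOn (fun p : W × W => p.1 * p.2) (D₁ ×ˢ D₂) D)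
    (hl : ∀ x ∈ D₁, ∀ y ∈ D₂, cs.length (x * y) = cs.length x + cs.length y) :
    twistedPoincare cs ρ D = twistedPoincare cs ρ D₁ * twistedPoincare cs ρ D₂ := by
  classical
  ext1 n
  rw [PowerSeries.coeff_mul]
  simp only [twistedPoincare, coeff_mk, Finset.sum_mul_sum, ← Finset.sum_product']
  rw [Finset.sum_sigma']
  symm
  refine Finset.sum_nbij (fun x => x.2.1 * x.2.2) ?_ ?_ ?_ ?_
  · rintro ⟨⟨i, j⟩, x, y⟩ h
    simp only [Finset.mem_sigma, Finset.mem_product, Set.Finite.mem_toFinset, Set.mem_ofPred_eq] at h ⊢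
    obtain ⟨hij, ⟨hx, rfl⟩, hy, rfl⟩ := h
    exact ⟨hD.mapsTo (Set.mk_mem_prod hx hy), (hl x hx y hy).trans
      (Finset.HasAntidiagonal.mem_antidiagonal.1 hij)⟩
  · rintro ⟨⟨i, j⟩, x, y⟩ h ⟨⟨i', j'⟩, x', y'⟩ h' heq
    simp only [Finset.coe_sigma, Set.mem_sigma_iff, Finset.mem_coe, Finset.mem_product,
      Set.Finite.mem_toFinset, Set.mem_ofPred_eq] at h h'
    obtain ⟨-, ⟨hx, rfl⟩, hy, rfl⟩ := h
    obtain ⟨-, ⟨hx', rfl⟩, hy', rfl⟩ := h'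
    have := hD.injOn (Set.mk_mem_prod hx hy) (Set.mk_mem_prod hx' hy') heq
    obtain ⟨rfl, rfl⟩ := Prod.ext_iff.1 this
    rfl
  · intro w hw
    simp only [Finset.mem_coe, Set.Finite.mem_toFinset, Set.mem_ofPred_eq] at hw
    obtain ⟨⟨x, y⟩, ⟨hx, hy⟩, rfl⟩ := hD.surjOn hw.1
    refine ⟨⟨(cs.length x, cs.length y), x, y⟩, ?_, rfl⟩
    have := hw.2
    dsimp only at hx hy this
    rw [hl x hx y hy] at this
    simpa [hx, hy] using this
  · rintro ⟨⟨i, j⟩, x, y⟩ h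
    simp only [Finset.mem_sigma, Finset.mem_product, Set.Finite.mem_toFinset, Set.mem_ofPred_eq] at h
    rw [HeckeAlgebra.e_mul cs (hl x h.2.1.1 y h.2.2.1), map_mul]

/-- The series of the powers of a straight element is a geometric series. -/
theorem twistedPoincare_powersSet_mul {w : W} (hw : ∀ n : ℕ, cs.length (w ^ n) = n * cs.length w)
    (h1 : cs.length w ≠ 0) :
    twistedPoincare cs ρ (powersSet w) * (1 - heckeTerm cs ρ w) = 1 := by
  have hinj : Function.Injective fun n : ℕ => w ^ n := by
    intro m n h
    have := congrArg cs.length h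
    simp only [hw] at this
    exact Nat.eq_of_mul_eq_mul_right (Nat.pos_of_ne_zero h1) this
  have h₁ : powersSet w = {1} ∪ Set.range fun n : ℕ => w ^ (n + 1) := by
    ext x
    constructor
    · rintro ⟨n, rfl⟩
      cases n with
      | zero => left; simp
      | succ n => right; exact ⟨n, rfl⟩
    · rintro (rfl | ⟨n, rfl⟩)
      · exact ⟨0, by simp⟩
      · exact ⟨n + 1, rfl⟩
  have h₂ : Disjoint {1} (Set.range fun n : ℕ => w ^ (n + 1)) := by
    rw [Set.disjoint_singleton_left]
    rintro ⟨n, hn⟩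
    have := hinj (a₁ := n + 1) (a₂ := 0) (by simpa using hn)
    omega
  -- Without 1, the set of powers is its own translate by w, so its series F satisfies F = 1 + F ·
  -- w.
  have h₃ : twistedPoincare cs ρ (Set.range fun n : ℕ => w ^ (n + 1)) =
      twistedPoincare cs ρ (powersSet w) * twistedPoincare cs ρ {w} := by
    refine twistedPoincare_mul cs ρ ⟨?_, ?_, ?_⟩ ?_
    · rintro ⟨x, y⟩ ⟨⟨n, rfl⟩, h⟩
      obtain rfl : y = w := h
      exact ⟨n, pow_succ y n⟩
    · rintro ⟨x, y⟩ ⟨-, h⟩ ⟨x', y'⟩ ⟨-, h'⟩ heq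
      obtain rfl : y = w := h
      obtain rfl : y' = y := h'
      rw [show x = x' from mul_right_cancel heq]
    · rintro _ ⟨n, rfl⟩
      exact ⟨(w ^ n, w), ⟨⟨n, rfl⟩, rfl⟩, (pow_succ w n).symm⟩
    · rintro _ ⟨n, rfl⟩ y rfl
      rw [← pow_succ, hw, hw]
      ring
  rw [twistedPoincare_singleton] at h₃
  have h₄ := twistedPoincare_union cs ρ h₂
  rw [← h₁, h₃, twistedPoincare_singleton, heckeTerm_one] at h₄
  rw [mul_sub, mul_one, sub_eq_iff_eq_add]
  exact h₄

/-- The decomposition of `W` with respect to a standard parabolic subgroup. -/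
theorem twistedPoincare_univ_eq_mul (I : Set B) :
    twistedPoincare cs ρ Set.univ = twistedPoincare cs ρ (cs.standardParabolic I) *
      twistedPoincare cs ρ (cs.minimalReps I) := by
  have h := cs.bijective_mul_minimalReps I
  refine twistedPoincare_mul cs ρ ⟨fun _ _ => Set.mem_univ _, ?_, ?_⟩ ?_
  · rintro ⟨x, y⟩ ⟨hx, hy⟩ ⟨x', y'⟩ ⟨hx', hy'⟩ heq
    have := h.1 (a₁ := (⟨x, hx⟩, ⟨y, hy⟩)) (a₂ := (⟨x', hx'⟩, ⟨y', hy'⟩)) heq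
    simpa using this
  · intro w _
    obtain ⟨⟨⟨x, hx⟩, y, hy⟩, hxy⟩ := h.2 w
    exact ⟨(x, y), ⟨hx, hy⟩, hxy⟩
  · intro x hx y hy
    exact cs.length_mul_of_mem_minimalReps hx hy

end Series

/-! ### Finite dihedral parabolic subgroups. -/

section Dihedral

namespace CoxeterSystem

variable {B : Type*} {M : CoxeterMatrix B} {W : Type*} [Group W] (cs : CoxeterSystem M W)

/-- Left multiplication by one of the two generators lengthens the alternating word by a letter and
by the other shortens it, a walk on a cycle of length 2m. -/
theorem coe_standardParabolic_pair (i j : B) (hM : M i j ≠ 0) :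
    (cs.standardParabolic {i, j} : Set W) =
      (fun n => cs.wordProd (alternatingWord i j n)) '' (Finset.range (2 * M i j)) := by
  have hper : cs.wordProd (alternatingWord i j (2 * M i j)) = 1 := by
    rw [wordProd, map_alternatingWord_prod, simple_mul_simple_pow]
  apply Set.Subset.antisymm
  · intro x hx
    have hstep : ∀ g ∈ ({i, j} : Set B), ∀ y ∈ (fun n => cs.wordProd (alternatingWord i j n)) ''
        (Finset.range (2 * M i j) : Set ℕ), cs.simple g * y ∈
        (fun n => cs.wordProd (alternatingWord i j n)) '' (Finset.range (2 * M i j) : Set ℕ) := by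
      rintro g hg _ ⟨n, hn, rfl⟩
      simp only [Finset.coe_range, Set.mem_Iio] at hn
      by_cases h : g = if Even n then j else i
      · have h₁ : cs.simple g * cs.wordProd (alternatingWord i j n) =
            cs.wordProd (alternatingWord i j (n + 1)) := by
          rw [alternatingWord_succ', wordProd_cons, h]
        rcases Nat.lt_or_ge (n + 1) (2 * M i j) with h₂ | h₂
        · exact ⟨n + 1, by simpa using h₂, h₁.symm⟩
        · have h₃ : n + 1 = 2 * M i j := by omega
          refine ⟨0, by simp; omega, ?_⟩
          dsimp only
          rw [h₁, h₃, hper]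
          simp [alternatingWord]
      · cases n with
        | zero =>
          have hgi : g = i := by
            simp only [Even.zero, if_true] at h
            exact hg.resolve_right h
          -- Stepping back from 0 on the cycle: the alternating word of length 2m - 1 represents
          -- s_i.
          refine ⟨2 * M i j - 1, by simp; omega, ?_⟩
          dsimp only
          rw [cs.prod_alternatingWord_eq_prod_alternatingWord_sub i j _ (by omega),
            show M i j * 2 - (2 * M i j - 1) = 1 by omega, hgi]
          simp [alternatingWord]
        | succ n =>
          refine ⟨n, by simp; omega, ?_⟩
          have hgn : g = if Even n then j else i := by
            rcases hg with rfl | hg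
            · by_cases hn : Even n <;> simp_all [Nat.even_add_one]
            · rw [Set.mem_singleton_iff] at hg
              subst hg
              by_cases hn : Even n <;> simp_all [Nat.even_add_one]
          dsimp only
          rw [alternatingWord_succ', wordProd_cons, ← hgn, simple_mul_simple_cancel_left]
    induction hx using Subgroup.closure_induction_left with
    | one => exact ⟨0, by simp; omega, by simp [alternatingWord]⟩
    | mul_left x hx y _ ih =>
      obtain ⟨g, hg, rfl⟩ := hx
      exact hstep g hg y ih
    | inv_mul_cancel x hx y _ ih =>
      obtain ⟨g, hg, rfl⟩ := hx
      rw [inv_simple]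
      exact hstep g hg y ih
  · rintro _ ⟨n, -, rfl⟩
    dsimp only
    induction n with
    | zero => simp [alternatingWord]
    | succ n ih =>
      rw [alternatingWord_succ', wordProd_cons]
      refine mul_mem (cs.simple_mem_standardParabolic ?_) ih
      split_ifs <;> simp

theorem isReduced_alternatingWord {i j : B} (h : cs.IsReduced (braidWord M i j)) {n : ℕ}
    (hn : n ≤ M i j) : cs.IsReduced (alternatingWord i j n) := by
  induction hn using Nat.decreasingInduction with
  | self => exact h
  | of_succ n _ ih =>
    rw [alternatingWord_succ'] at ih
    simpa using ih.drop 1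

theorem isReduced_braidWord_symm {i j : B} (h : cs.IsReduced (braidWord M i j)) :
    cs.IsReduced (braidWord M j i) := by
  have := h.eq
  rw [wordProd_braidWord_eq, length_alternatingWord] at this
  rw [IsReduced, this, length_alternatingWord, M.symmetric]

theorem injOn_wordProd_alternatingWord {i j : B} (h : cs.IsReduced (braidWord M i j)) :
    Set.InjOn (fun n => cs.wordProd (alternatingWord i j n)) (Finset.range (2 * M i j)) := by
  have h₁ : ∀ n ≤ M i j, cs.length (cs.wordProd (alternatingWord i j n)) = n := fun n hn => by
    rw [(cs.isReduced_alternatingWord h hn).eq, length_alternatingWord]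
  have h₂ : ∀ n ≤ M i j, cs.length (cs.wordProd (alternatingWord j i n)) = n := fun n hn => by
    rw [(cs.isReduced_alternatingWord (cs.isReduced_braidWord_symm h)
      (by rwa [M.symmetric])).eq, length_alternatingWord]
  have h₃ : ∀ n, M i j ≤ n → n < 2 * M i j →
      cs.length (cs.wordProd (alternatingWord i j n)) = 2 * M i j - n := fun n hn hn' => by
    rw [cs.prod_alternatingWord_eq_prod_alternatingWord_sub i j n (by omega), h₂ _ (by omega)]
    omega
  have h₄ : ∀ m n, m < n → n < 2 * M i j →
      cs.wordProd (alternatingWord i j m) ≠ cs.wordProd (alternatingWord i j n) := by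
    intro m n hmn hn heq
    have hl := congrArg cs.length heq
    rcases Nat.lt_or_ge n (M i j) with h₅ | h₅
    · rw [h₁ m (by omega), h₁ n (by omega)] at hl
      omega
    rcases Nat.lt_or_ge m (M i j) with h₆ | h₆
    · rw [h₁ m h₆.le, h₃ n h₅ hn] at hl
      rw [cs.prod_alternatingWord_eq_prod_alternatingWord_sub i j n (by omega),
        show M i j * 2 - n = m by omega] at heq
      obtain ⟨m, rfl⟩ : ∃ m', m = m' + 1 := ⟨m - 1, by omega⟩
      -- Two alternating words of equal length below m, ending in i and in j, are told apart by
      -- right multiplication by s_j: one gets longer, the other shorter.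
      have h₇ := congrArg cs.length (congrArg (fun x => x * cs.simple j) heq)
      have h₈ : cs.wordProd (alternatingWord i j (m + 1)) * cs.simple j =
          cs.wordProd (alternatingWord j i m) := by
        rw [alternatingWord_succ i j m, wordProd_concat, simple_mul_simple_cancel_right]
      have h₉ : cs.wordProd (alternatingWord j i (m + 1)) * cs.simple j =
          cs.wordProd (alternatingWord i j (m + 1 + 1)) := by
        rw [← wordProd_concat, ← alternatingWord_succ]
      rw [h₈, h₉, h₂ m (by omega), h₁ (m + 1 + 1) (by omega)] at h₇
      omega
    · rw [h₃ m h₆ (by omega), h₃ n h₅ hn] at hl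
      omega
  intro m hm n hn heq
  simp only [Finset.coe_range, Set.mem_Iio] at hm hn
  rcases lt_trichotomy m n with h₅ | h₅ | h₅
  · exact absurd heq (h₄ m n h₅ hn)
  · exact h₅
  · exact absurd heq.symm (h₄ n m h₅ hm)

end CoxeterSystem

variable {B : Type*} {M : CoxeterMatrix B} {W : Type*} [Group W] {k : Type*} [Field k]
  (cs : CoxeterSystem M W) {q : k} {V : Type*} [AddCommGroup V] [Module k V]
  (ρ : HeckeAlgebra cs q →ₐ[k] Module.End k V)

theorem prod_alternatingWord_heckeTerm {i j : B}
    (h : cs.IsReduced (CoxeterSystem.braidWord M i j)) :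
    ((CoxeterSystem.alternatingWord i j (M i j)).map
      fun i => heckeTerm cs ρ (cs.simple i)).prod =
    ((CoxeterSystem.alternatingWord j i (M i j)).map
      fun i => heckeTerm cs ρ (cs.simple i)).prod := by
  rw [← heckeTerm_wordProd cs ρ h, cs.wordProd_braidWord_eq,
    heckeTerm_wordProd cs ρ (cs.isReduced_braidWord_symm h), M.symmetric]

variable [Finite B]

/-- The twisted Poincaré series of a finite dihedral parabolic subgroup. -/
theorem twistedPoincare_pair {i j : B} (hM : M i j ≠ 0)
    (h : cs.IsReduced (CoxeterSystem.braidWord M i j)) :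
    twistedPoincare cs ρ (cs.standardParabolic {i, j}) =
      ∑ n ∈ Finset.range (M i j), (((CoxeterSystem.alternatingWord i j n).map
          fun i => heckeTerm cs ρ (cs.simple i)).prod +
        ((CoxeterSystem.alternatingWord j i (n + 1)).map
          fun i => heckeTerm cs ρ (cs.simple i)).prod) := by
  rw [cs.coe_standardParabolic_pair i j hM,
    twistedPoincare_image cs ρ _ _ (cs.injOn_wordProd_alternatingWord h), two_mul,
    Finset.sum_range_add, Finset.sum_add_distrib]
  congr 1
  · refine Finset.sum_congr rfl fun n hn => ?_
    rw [Finset.mem_range] at hn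
    exact heckeTerm_wordProd cs ρ (cs.isReduced_alternatingWord h hn.le)
  -- The second half of the cycle, read backwards, gives the reduced words of lengths 1 to m ending
  -- in i; the longest element is thus counted once.
  · rw [← Finset.sum_range_reflect]
    refine Finset.sum_congr rfl fun n hn => ?_
    rw [Finset.mem_range] at hn
    rw [cs.prod_alternatingWord_eq_prod_alternatingWord_sub i j _ (by omega),
      show M i j * 2 - (M i j + (M i j - 1 - n)) = n + 1 by omega]
    exact heckeTerm_wordProd cs ρ (cs.isReduced_alternatingWord (cs.isReduced_braidWord_symm h)
      (by rw [M.symmetric]; omega))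

theorem twistedPoincare_simple (i : B) :
    twistedPoincare cs ρ (cs.standardParabolic {i}) = 1 + heckeTerm cs ρ (cs.simple i) := by
  have h : (cs.standardParabolic {i} : Set W) = {1} ∪ {cs.simple i} := by
    ext x
    rw [CoxeterSystem.standardParabolic, Set.image_singleton]
    simp only [SetLike.mem_coe, Set.singleton_union, Set.mem_insert_iff, Set.mem_singleton_iff]
    constructor
    · intro hx
      induction hx using Subgroup.closure_induction with
      | mem x hx => exact Or.inr hx
      | one => exact Or.inl rfl
      | mul x y _ _ hx hy => rcases hx with rfl | rfl <;> rcases hy with rfl | rfl <;> simp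
      | inv x _ hx => rcases hx with rfl | rfl <;> simp
    · rintro (rfl | rfl)
      · exact one_mem _
      · exact Subgroup.subset_closure rfl
  rw [h, twistedPoincare_union, twistedPoincare_singleton, twistedPoincare_singleton,
    heckeTerm_one]
  rw [Set.disjoint_singleton]
  intro h
  have := cs.length_simple i
  rw [← h, cs.length_one] at this
  omega

end Dihedral

/-! ### The alternating sum over descent sets. -/

section InclusionExclusion

variable {M : CoxeterMatrix (Fin 3)} {W : Type*} [Group W] {k : Type*} [Field k]
  (cs : CoxeterSystem M W) {q : k} {V : Type*} [AddCommGroup V] [Module k V]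
  (ρ : HeckeAlgebra cs q →ₐ[k] Module.End k V)

/-- Inclusion-exclusion over the sets of left descents. -/
theorem twistedPoincare_inclusion_exclusion (h : ∀ n, ∃ w, n < cs.length w) :
    twistedPoincare cs ρ Set.univ - twistedPoincare cs ρ (cs.minimalReps {0})
      - twistedPoincare cs ρ (cs.minimalReps {1}) - twistedPoincare cs ρ (cs.minimalReps {2})
      + twistedPoincare cs ρ (cs.minimalReps {0, 1}) + twistedPoincare cs ρ (cs.minimalReps {0, 2})
      + twistedPoincare cs ρ (cs.minimalReps {1, 2}) = 1 := by
  classical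
  have h1 : twistedPoincare cs ρ {w | ∀ i, ¬ cs.IsLeftDescent w i} = 1 := by
    rw [← heckeTerm_one cs ρ, ← twistedPoincare_singleton]
    congr 1
    ext w
    simp only [Set.mem_ofPred_eq, Set.mem_singleton_iff]
    constructor
    · intro hw
      by_contra h1
      obtain ⟨i, hi⟩ := cs.exists_leftDescent_of_ne_one h1
      exact hw i hi
    · rintro rfl i
      exact cs.not_isLeftDescent_one i
  rw [← h1]
  ext1 n
  simp only [map_sub, map_add, coeff_twistedPoincare, ← Finset.sum_sub_distrib,
    ← Finset.sum_add_distrib]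
  refine Finset.sum_congr rfl fun w _ => ?_
  -- Such a w would have maximal length, but lengths are unbounded.
  have hw : ¬ (cs.IsLeftDescent w 0 ∧ cs.IsLeftDescent w 1 ∧ cs.IsLeftDescent w 2) := by
    rintro ⟨h₀, h₁, h₂⟩
    obtain ⟨x, hx⟩ := h (cs.length w)
    have := cs.length_le_of_forall_isLeftDescent (w := w)
      (by intro i; fin_cases i <;> assumption) x
    omega
  simp only [CoxeterSystem.minimalReps, Set.mem_ofPred_eq, Set.mem_univ, Set.mem_insert_iff,
    Set.mem_singleton_iff, forall_eq_or_imp, forall_eq, Fin.forall_fin_succ, Fin.succ_zero_eq_one,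
    IsEmpty.forall_iff, and_true, Fin.succ_one_eq_two]
  by_cases h₀ : cs.IsLeftDescent w 0 <;> by_cases h₁ : cs.IsLeftDescent w 1 <;>
    by_cases h₂ : cs.IsLeftDescent w 2 <;> simp_all

end InclusionExclusion

/-! ### Determinants of operator-valued series. -/

section Matrices

variable {k : Type*} [Field k] {V : Type*} [AddCommGroup V] [Module k V]

/-- The matrix of a power series with coefficients in `End(V)`, as a ring homomorphism. -/
noncomputable def seriesMatrixHom {ι : Type*} [Fintype ι] [DecidableEq ι] (b : Module.Basis ι k V) :
    PowerSeries (Module.End k V) →+* Matrix ι ι k⟦X⟧ where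
  toFun := seriesMatrix b
  map_mul' := seriesMatrix_mul b
  map_zero' := by
    ext i j n
    simp [seriesMatrix]
  map_add' F G := by
    ext i j n
    simp [seriesMatrix]
  map_one' := by
    ext i j n
    rw [seriesMatrix, Matrix.of_apply, coeff_mk, PowerSeries.coeff_one, Matrix.one_apply]
    by_cases hn : n = 0
    · subst hn
      simp only [if_true, LinearMap.toMatrix_one, Matrix.one_apply]
      split_ifs <;> simp
    · rw [if_neg hn, map_zero]
      split_ifs <;> simp [PowerSeries.coeff_one, hn]

variable [FiniteDimensional k V]

theorem seriesDet_eq_det (F : PowerSeries (Module.End k V)) :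
    seriesDet F = (seriesMatrixHom (Module.finBasis k V) F).det := rfl

theorem seriesDet_one : seriesDet (1 : PowerSeries (Module.End k V)) = 1 := by
  rw [seriesDet_eq_det, map_one, Matrix.det_one]

theorem seriesDet_mul (F G : PowerSeries (Module.End k V)) :
    seriesDet (F * G) = seriesDet F * seriesDet G := by
  rw [seriesDet_eq_det, map_mul, Matrix.det_mul]
  rfl

theorem isUnit_seriesMatrixHom {F : PowerSeries (Module.End k V)} (hF : coeff 0 F = 1) :
    IsUnit (seriesMatrixHom (Module.finBasis k V) F) := by
  rw [Matrix.isUnit_iff_isUnit_det, ← seriesDet_eq_det, PowerSeries.isUnit_iff_constantCoeff,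
    constantCoeff_seriesDet F hF]
  exact isUnit_one

end Matrices

/-! ### Assembly of the identity. -/

section Main

variable {W : Type*} [Group W] {k : Type*} [Field k] {q : k} {V : Type*} [AddCommGroup V]
  [Module k V]

theorem AffineType.coxeterMatrix_ne_zero (T : AffineType) (i j : Fin 3) :
    T.coxeterMatrix i j ≠ 0 := by
  cases T <;> fin_cases i <;> fin_cases j <;> decide

theorem length_stripElement₁ (T : AffineType) (cs : CoxeterSystem T.coxeterMatrix W) :
    cs.length (stripElement₁ T cs) = (stripWord₁ T).length := by
  simpa using length_stripElement₁_pow T cs 1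

theorem length_stripElement₂ (T : AffineType) (cs : CoxeterSystem T.coxeterMatrix W) :
    cs.length (stripElement₂ T cs) = (stripWord₂ T).length := by
  simpa using length_stripElement₂_pow T cs 1

theorem exists_lt_length (T : AffineType) (cs : CoxeterSystem T.coxeterMatrix W) (n : ℕ) :
    ∃ w, n < cs.length w := by
  refine ⟨stripElement₁ T cs ^ (n + 1), ?_⟩
  rw [length_stripElement₁_pow]
  cases T <;> simp [stripWord₁] <;> omega

theorem heckeTerm_stripElement₁ (T : AffineType) (cs : CoxeterSystem T.coxeterMatrix W)
    (ρ : HeckeAlgebra cs q →ₐ[k] Module.End k V) :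
    heckeTerm cs ρ (stripElement₁ T cs) =
      ((stripWord₁ T).map fun i => heckeTerm cs ρ (cs.simple i)).prod := by
  rw [← wordProd_stripWord₁, heckeTerm_wordProd]
  rw [CoxeterSystem.IsReduced, wordProd_stripWord₁, length_stripElement₁]

theorem heckeTerm_stripElement₂ (T : AffineType) (cs : CoxeterSystem T.coxeterMatrix W)
    (ρ : HeckeAlgebra cs q →ₐ[k] Module.End k V) :
    heckeTerm cs ρ (stripElement₂ T cs) =
      ((stripWord₂ T).map fun i => heckeTerm cs ρ (cs.simple i)).prod := by
  rw [← wordProd_stripWord₂, heckeTerm_wordProd]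
  rw [CoxeterSystem.IsReduced, wordProd_stripWord₂, length_stripElement₂]

/-- The alternating formula for the inverse of the Poincaré series of an infinite Coxeter group
of rank three, over any ring in which the series become units. -/
theorem inv_twistedPoincare_univ {M : CoxeterMatrix (Fin 3)} (cs : CoxeterSystem M W)
    (h : ∀ n, ∃ w, n < cs.length w)
    (ρ : HeckeAlgebra cs q →ₐ[k] Module.End k V) {R : Type*} [Ring R]
    (Φ : PowerSeries (Module.End k V) →+* R) (U : Set (Fin 3) → Rˣ)
    (hU : ∀ I, (U I : R) = Φ (twistedPoincare cs ρ (cs.standardParabolic I)))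
    (X : Rˣ) (hX : (X : R) = Φ (twistedPoincare cs ρ Set.univ)) :
    (↑X⁻¹ : R) = 1 - ↑(U {0})⁻¹ - ↑(U {1})⁻¹ - ↑(U {2})⁻¹ + ↑(U {0, 1})⁻¹ + ↑(U {0, 2})⁻¹ +
      ↑(U {1, 2})⁻¹ := by
  -- Each series of minimal representatives has X as right factor, which is then cancelled from the
  -- inclusion-exclusion formula.
  have h₁ : ∀ I, Φ (twistedPoincare cs ρ (cs.minimalReps I)) = ↑(U I)⁻¹ * X := fun I => by
    rw [hX, twistedPoincare_univ_eq_mul cs ρ I, map_mul, ← hU, Units.inv_mul_cancel_left]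
  have h₂ := congrArg Φ (twistedPoincare_inclusion_exclusion cs ρ h)
  simp only [map_add, map_sub, h₁, map_one, ← hX] at h₂
  have h₃ := congrArg (· * (↑X⁻¹ : R)) h₂
  simpa only [add_mul, sub_mul, Units.mul_inv_cancel_right, one_mul, Units.mul_inv] using h₃.symm

/-- The determinant identity in an arbitrary ring, for elements satisfying the braid relations. -/
theorem det_identity (T : AffineType) {R K : Type*} [Ring R] [CommRing K] (d : R →* K)
    (hd : ∀ x y, d (1 - x * y) = d (1 - y * x)) (a : Fin 3 → R) (U : Set (Fin 3) → Rˣ) (X : Rˣ)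
    (hs : ∀ i, (U {i} : R) = 1 + a i)
    (hp : ∀ i j, i ≠ j → (U {i, j} : R) = ∑ n ∈ Finset.range (T.coxeterMatrix i j),
      (((CoxeterSystem.alternatingWord i j n).map a).prod +
        ((CoxeterSystem.alternatingWord j i (n + 1)).map a).prod))
    (hb : ∀ i j, i ≠ j →
      ((CoxeterSystem.alternatingWord i j (T.coxeterMatrix i j)).map a).prod =
      ((CoxeterSystem.alternatingWord j i (T.coxeterMatrix i j)).map a).prod)
    (hX : (↑X⁻¹ : R) = 1 - ↑(U {0})⁻¹ - ↑(U {1})⁻¹ - ↑(U {2})⁻¹ + ↑(U {0, 1})⁻¹ + ↑(U {0, 2})⁻¹ +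
      ↑(U {1, 2})⁻¹) :
    d (U {0, 1}) * d (U {0, 2}) * d (U {1, 2}) = d X * d (U {0}) * d (U {1}) * d (U {2}) *
      d (1 - ((stripWord₁ T).map a).prod) * d (1 - ((stripWord₂ T).map a).prod) := by
  have hp01 := hp 0 1 (by decide)
  have hp02 := hp 0 2 (by decide)
  have hp12 := hp 1 2 (by decide)
  have hb01 := hb 0 1 (by decide)
  have hb02 := hb 0 2 (by decide)
  have hb12 := hb 1 2 (by decide)
  clear hp hb
  cases T
  · have e01 : AffineType.A2.coxeterMatrix 0 1 = 3 := rfl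
    have e02 : AffineType.A2.coxeterMatrix 0 2 = 3 := rfl
    have e12 : AffineType.A2.coxeterMatrix 1 2 = 3 := rfl
    simp only [e01, e02, e12, Finset.sum_range_succ, Finset.sum_range_zero,
      CoxeterSystem.alternatingWord, List.concat_eq_append, List.nil_append, List.cons_append,
      List.map_cons, List.map_nil, List.prod_cons, List.prod_nil, mul_one]
      at hp01 hp02 hp12 hb01 hb02 hb12
    refine (det_identity_A2 d hd (U {0}) (U {1}) (U {2}) (U {0, 1}) (U {0, 2})
      (U {1, 2}) X (a := a 0) (b := a 1) (c := a 2) ?_ ?_ (hs 0) (hs 1) (hs 2) ?_ ?_ ?_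
      hX).trans ?_
    -- `alternatingWord i j` ends in j; for odd m it also begins with j, so the relation reads bab =
    -- aba and enters with a minus sign.
    · linear_combination (norm := noncomm_ring) - hb01
    · linear_combination (norm := noncomm_ring) - hb12
    · rw [hp01]; noncomm_ring
    · rw [hp02]; noncomm_ring
    · rw [hp12]; noncomm_ring
    · simp only [stripWord₁, stripWord₂, List.map_cons, List.map_nil, List.prod_cons,
        List.prod_nil, mul_one, mul_assoc]
  · have e01 : AffineType.C2.coxeterMatrix 0 1 = 4 := rfl
    have e02 : AffineType.C2.coxeterMatrix 0 2 = 4 := rfl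
    have e12 : AffineType.C2.coxeterMatrix 1 2 = 2 := rfl
    simp only [e01, e02, e12, Finset.sum_range_succ, Finset.sum_range_zero,
      CoxeterSystem.alternatingWord, List.concat_eq_append, List.nil_append, List.cons_append,
      List.map_cons, List.map_nil, List.prod_cons, List.prod_nil, mul_one]
      at hp01 hp02 hp12 hb01 hb02 hb12
    refine (det_identity_C2 d (U {0}) (U {1}) (U {2}) (U {0, 1}) (U {0, 2})
      (U {1, 2}) X (a := a 0) (b := a 1) (c := a 2) ?_ ?_ (hs 0) (hs 1) (hs 2) ?_ ?_ ?_
      hX).trans ?_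
    · linear_combination (norm := noncomm_ring) hb12
    · linear_combination (norm := noncomm_ring) hb01
    -- For even m the sum lists the longest element as baba, whereas the factorization with 1 + a on
    -- the left produces abab.
    · rw [hp01]; linear_combination (norm := noncomm_ring) - hb01
    · rw [hp02]; linear_combination (norm := noncomm_ring) - hb02
    · rw [hp12]; linear_combination (norm := noncomm_ring) - hb12
    · simp only [stripWord₁, stripWord₂, List.map_cons, List.map_nil, List.prod_cons,
        List.prod_nil, mul_one, mul_assoc]
  · have e01 : AffineType.G2.coxeterMatrix 0 1 = 6 := rfl
    have e02 : AffineType.G2.coxeterMatrix 0 2 = 3 := rfl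
    have e12 : AffineType.G2.coxeterMatrix 1 2 = 2 := rfl
    simp only [e01, e02, e12, Finset.sum_range_succ, Finset.sum_range_zero,
      CoxeterSystem.alternatingWord, List.concat_eq_append, List.nil_append, List.cons_append,
      List.map_cons, List.map_nil, List.prod_cons, List.prod_nil, mul_one]
      at hp01 hp02 hp12 hb01 hb02 hb12
    refine (det_identity_G2 d hd (U {0}) (U {1}) (U {2}) (U {0, 1}) (U {0, 2})
      (U {1, 2}) X (a := a 0) (b := a 1) (c := a 2) ?_ ?_ ?_ (hs 0) (hs 1) (hs 2) ?_ ?_ ?_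
      hX).trans ?_
    · linear_combination (norm := noncomm_ring) hb12
    · linear_combination (norm := noncomm_ring) - hb02
    · linear_combination (norm := noncomm_ring) hb01
    · rw [hp01]; linear_combination (norm := noncomm_ring) - hb01
    · rw [hp02]; noncomm_ring
    · rw [hp12]; linear_combination (norm := noncomm_ring) - hb12
    · simp only [stripWord₁, stripWord₂, List.map_cons, List.map_nil, List.prod_cons,
        List.prod_nil, mul_one, mul_assoc]

/-- Stated for abstract Φ and d, because all that is needed of matrices and determinants is that
series with constant term 1 become units and that d(1 - xy) = d(1 - yx). -/
theorem det_poincare_identity (T : AffineType) (cs : CoxeterSystem T.coxeterMatrix W)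
    (ρ : HeckeAlgebra cs q →ₐ[k] Module.End k V) {R K : Type*} [Ring R] [CommRing K]
    (Φ : PowerSeries (Module.End k V) →+* R) (d : R →* K)
    (hΦ : ∀ F, coeff 0 F = 1 → IsUnit (Φ F)) (hd : ∀ x y, d (1 - x * y) = d (1 - y * x)) :
    d (Φ (twistedPoincare cs ρ (cs.standardParabolic {0, 1}))) *
      d (Φ (twistedPoincare cs ρ (cs.standardParabolic {0, 2}))) *
      d (Φ (twistedPoincare cs ρ (cs.standardParabolic {1, 2}))) =
    d (Φ (twistedPoincare cs ρ Set.univ)) *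
      d (Φ (twistedPoincare cs ρ (cs.standardParabolic {0}))) *
      d (Φ (twistedPoincare cs ρ (cs.standardParabolic {1}))) *
      d (Φ (twistedPoincare cs ρ (cs.standardParabolic {2}))) *
      d (Φ (1 - ((stripWord₁ T).map fun i => heckeTerm cs ρ (cs.simple i)).prod)) *
      d (Φ (1 - ((stripWord₂ T).map fun i => heckeTerm cs ρ (cs.simple i)).prod)) := by
  have hu : ∀ D : Set W, 1 ∈ D → IsUnit (Φ (twistedPoincare cs ρ D)) := fun D hD =>
    hΦ _ (coeff_zero_twistedPoincare cs ρ D hD)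
  choose U hU using fun I : Set (Fin 3) => hu (cs.standardParabolic I) (one_mem _)
  obtain ⟨X, hX⟩ := hu Set.univ (Set.mem_univ _)
  have hinv := inv_twistedPoincare_univ cs (exists_lt_length T cs) ρ Φ U hU X hX
  let a : Fin 3 → R := fun i => Φ (heckeTerm cs ρ (cs.simple i))
  have hw : ∀ ω : List (Fin 3),
      Φ (ω.map fun i => heckeTerm cs ρ (cs.simple i)).prod = (ω.map a).prod := fun ω => by
    rw [map_list_prod, List.map_map]; rfl
  have hs : ∀ i, (U {i} : R) = 1 + a i := fun i => by
    rw [hU, twistedPoincare_simple, map_add, map_one]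
  have hp : ∀ i j, i ≠ j → (U {i, j} : R) =
      ∑ n ∈ Finset.range (T.coxeterMatrix i j),
        (((CoxeterSystem.alternatingWord i j n).map a).prod +
          ((CoxeterSystem.alternatingWord j i (n + 1)).map a).prod) := fun i j hij => by
    rw [hU, twistedPoincare_pair cs ρ (T.coxeterMatrix_ne_zero i j)
      (isReduced_braidWord T cs i j hij), map_sum]
    simp only [map_add, hw]
  have hb : ∀ i j, i ≠ j →
      ((CoxeterSystem.alternatingWord i j (T.coxeterMatrix i j)).map a).prod =
      ((CoxeterSystem.alternatingWord j i (T.coxeterMatrix i j)).map a).prod := fun i j hij => by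
    rw [← hw, ← hw]
    exact congrArg Φ (prod_alternatingWord_heckeTerm cs ρ (isReduced_braidWord T cs i j hij))
  have key := det_identity T d hd a U X hs hp hb hinv
  rw [map_sub Φ, map_sub Φ, map_one Φ, hw, hw, ← hX, ← hU, ← hU, ← hU, ← hU, ← hU, ← hU]
  exact key

variable [FiniteDimensional k V]

theorem seriesDet_powersSet_stripElement₁ (T : AffineType) (cs : CoxeterSystem T.coxeterMatrix W)
    (ρ : HeckeAlgebra cs q →ₐ[k] Module.End k V) :
    seriesDet (twistedPoincare cs ρ (powersSet (stripElement₁ T cs))) *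
      seriesDet (1 - ((stripWord₁ T).map fun i => heckeTerm cs ρ (cs.simple i)).prod) = 1 := by
  rw [← seriesDet_mul, ← heckeTerm_stripElement₁, twistedPoincare_powersSet_mul, seriesDet_one]
  · intro n
    rw [length_stripElement₁_pow, length_stripElement₁]
  · rw [length_stripElement₁]
    cases T <;> simp [stripWord₁]

theorem seriesDet_powersSet_stripElement₂ (T : AffineType) (cs : CoxeterSystem T.coxeterMatrix W)
    (ρ : HeckeAlgebra cs q →ₐ[k] Module.End k V) :
    seriesDet (twistedPoincare cs ρ (powersSet (stripElement₂ T cs))) *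
      seriesDet (1 - ((stripWord₂ T).map fun i => heckeTerm cs ρ (cs.simple i)).prod) = 1 := by
  rw [← seriesDet_mul, ← heckeTerm_stripElement₂, twistedPoincare_powersSet_mul, seriesDet_one]
  · intro n
    rw [length_stripElement₂_pow, length_stripElement₂]
  · rw [length_stripElement₂]
    cases T <;> simp [stripWord₂]

theorem detAlt_eq {M : CoxeterMatrix (Fin 3)} (cs : CoxeterSystem M W)
    (ρ : HeckeAlgebra cs q →ₐ[k] Module.End k V) :
    detAlt cs ρ = seriesDet (twistedPoincare cs ρ Set.univ) *
      seriesDet (twistedPoincare cs ρ (cs.standardParabolic {0})) *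
      seriesDet (twistedPoincare cs ρ (cs.standardParabolic {1})) *
      seriesDet (twistedPoincare cs ρ (cs.standardParabolic {2})) *
      (seriesDet (twistedPoincare cs ρ (cs.standardParabolic {0, 1})))⁻¹ *
      (seriesDet (twistedPoincare cs ρ (cs.standardParabolic {0, 2})))⁻¹ *
      (seriesDet (twistedPoincare cs ρ (cs.standardParabolic {1, 2})))⁻¹ := by
  have hp : ∀ I : Finset (Fin 3), parabolic cs I = cs.standardParabolic (I : Set (Fin 3)) :=
    fun I => rfl
  have h₀ : twistedPoincare cs ρ (cs.standardParabolic ∅) = 1 := by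
    rw [← heckeTerm_one cs ρ, ← twistedPoincare_singleton]
    simp [CoxeterSystem.standardParabolic]
  have h₁ : (cs.standardParabolic {0, 1, 2} : Set W) = Set.univ := by
    rw [CoxeterSystem.standardParabolic, show ({0, 1, 2} : Set (Fin 3)) = Set.univ by
      ext i; fin_cases i <;> simp, Set.image_univ, cs.subgroup_closure_range_simple]
    rfl
  have hU : (Finset.univ : Finset (Finset (Fin 3))) =
      {∅, {0}, {1}, {2}, {0, 1}, {0, 2}, {1, 2}, {0, 1, 2}} := by decide
  rw [detAlt, hU]
  simp only [hp]
  rw [Finset.prod_insert (by decide), Finset.prod_insert (by decide),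
    Finset.prod_insert (by decide), Finset.prod_insert (by decide),
    Finset.prod_insert (by decide), Finset.prod_insert (by decide),
    Finset.prod_insert (by decide), Finset.prod_singleton]
  rw [if_neg (by decide), if_pos (by decide), if_pos (by decide), if_pos (by decide),
    if_neg (by decide), if_neg (by decide), if_neg (by decide), if_pos (by decide)]
  simp only [Finset.coe_empty, Finset.coe_singleton, Finset.coe_insert, h₀, h₁, seriesDet_one]
  have h1 : (1 : k⟦X⟧)⁻¹ = 1 := by
    rw [PowerSeries.inv_eq_iff_mul_eq_one (by simp), mul_one]
  rw [h1]
  ring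

end Main

theorem mainTheorem3 {W : Type*} [Group W] (T : AffineType)
    (cs : CoxeterSystem T.coxeterMatrix W) {k : Type*} [Field k] (q : k)
    {V : Type*} [AddCommGroup V] [Module k V] [FiniteDimensional k V]
    (ρ : HeckeAlgebra cs q →ₐ[k] Module.End k V) :
    seriesDet (twistedPoincare cs ρ (powersSet (stripElement₁ T cs))) *
        seriesDet (twistedPoincare cs ρ (powersSet (stripElement₂ T cs))) =
      detAlt cs ρ := by
  have hne : ∀ I : Set (Fin 3), constantCoeff
      (seriesDet (twistedPoincare cs ρ (cs.standardParabolic I))) ≠ 0 := fun I => by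
    rw [constantCoeff_seriesDet _ (coeff_zero_twistedPoincare cs ρ _ (one_mem _))]
    exact one_ne_zero
  have h₁ := seriesDet_powersSet_stripElement₁ T cs ρ
  have h₂ := seriesDet_powersSet_stripElement₂ T cs ρ
  have h := det_poincare_identity T cs ρ (seriesMatrixHom (Module.finBasis k V))
    Matrix.detMonoidHom (fun F hF => isUnit_seriesMatrixHom hF)
    fun x y => Matrix.det_one_sub_mul_comm x y
  simp only [Matrix.coe_detMonoidHom, ← seriesDet_eq_det] at h
  rw [detAlt_eq, PowerSeries.eq_mul_inv_iff_mul_eq (hne _),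
    PowerSeries.eq_mul_inv_iff_mul_eq (hne _), PowerSeries.eq_mul_inv_iff_mul_eq (hne _)]
  set P := seriesDet (twistedPoincare cs ρ Set.univ) *
      seriesDet (twistedPoincare cs ρ (cs.standardParabolic {0})) *
      seriesDet (twistedPoincare cs ρ (cs.standardParabolic {1})) *
      seriesDet (twistedPoincare cs ρ (cs.standardParabolic {2}))
  set D₁ := seriesDet (1 - ((stripWord₁ T).map fun i => heckeTerm cs ρ (cs.simple i)).prod)
  set D₂ := seriesDet (1 - ((stripWord₂ T).map fun i => heckeTerm cs ρ (cs.simple i)).prod)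
  set H₁ := seriesDet (twistedPoincare cs ρ (powersSet (stripElement₁ T cs)))
  set H₂ := seriesDet (twistedPoincare cs ρ (powersSet (stripElement₂ T cs)))
  -- Multiply `h` by H₁H₂ and cancel H₁D₁ = 1 and H₂D₂ = 1.
  linear_combination H₁ * H₂ * h + P * H₂ * D₂ * h₁ + P * h₂
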